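/- **Theorem C.** For $0<\alpha<1$ let $\mathrm{Diff}_+^{1+\alpha}([0,1])$ be the group of orientation-preserving $C^1$-diffeomorphisms $f$ of $[0,1]$ such that the derivatives of $f$ and $f^{-1}$ are $\alpha$-Hölder continuous. For every $0<\alpha<1$ and every integer $d\ge 1$, the group $\mathrm{Diff}_+^{1+\alpha}([0,1])$ contains a metabelian subgroup $\Gamma$ (that is, the second derived subgroup of $\Gamma$ is trivial) that is nilpotent of nilpotence degree exactly $d$. Moreover, $\Gamma$ can be chosen as follows. There are real numbers $p,q>1$ with $S:=\sum_{(i,j)\in\mathbb{Z}^2}\frac{1}{|i|^p+|j|^q+1}<\infty$, and if $I_{i,j}$, $(i,j)\in\mathbb Z^2$, are the closed subintervals of $[0,1]$ of length $\frac{1}{S}\cdot\frac{1}{|i|^p+|j|^q+1}$ joined from left to right in the lexicographic order of the indices $(i,j)$, then $\Gamma$ is generated by elements $f,g_0,\dots,g_{d-1}$ of $\mathrm{Diff}_+^{1+\alpha}([0,1])$ such that, for all $i,j\in\mathbb{Z}$ and $0\le k<d$, $$f(I_{i,j})=I_{i+1,j},\qquad g_k(I_{i,j})=I_{i,\,j+r_k(i)},\qquad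 r_0(i)=1,\quad r_k(i)=\frac{i(i+1)\cdots(i+k-1)}{k!}.$$ -/

import Mathlib

open Set
open scoped unitInterval Nat

noncomputable section

namespace HolderDiff

/-- A self-map of `[0,1]`, seen as a real function on the line: outside `[0,1]` it is extended by
constants, but only its values on `[0,1]` are ever used. -/
def toReal (f : I → I) : ℝ → ℝ := fun x => (f (projIcc 0 1 zero_le_one x) : ℝ)

/-- `f : [0,1] → [0,1]` is of class `C^{1+α}`: it is `C^1` on `[0,1]` (with one-sided derivatives at
the two endpoints) and its derivative is `α`-Hölder continuous. -/
def IsC1Holder (α : ℝ) (f : I → I) : Prop :=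
  ContDiffOn ℝ 1 (toReal f) (Icc 0 1) ∧
    ∃ M : ℝ, ∀ x ∈ Icc (0 : ℝ) 1, ∀ y ∈ Icc (0 : ℝ) 1,
      |derivWithin (toReal f) (Icc 0 1) x - derivWithin (toReal f) (Icc 0 1) y| ≤ M * |x - y| ^ α

theorem mapsTo_toReal (f : I → I) : MapsTo (toReal f) (Icc 0 1) (Icc 0 1) :=
  fun _ _ => (f _).2

theorem toReal_comp (f g : I → I) : toReal (f ∘ g) = toReal f ∘ toReal g := by
  funext x
  simp [toReal]

theorem toReal_id {x : ℝ} (hx : x ∈ Icc (0 : ℝ) 1) : toReal id x = x := by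
  simp [toReal, projIcc_of_mem _ hx]

theorem IsC1Holder.id (α : ℝ) : IsC1Holder α (id : I → I) := by
  refine ⟨contDiffOn_id.congr fun x hx => toReal_id hx, 0, fun x hx y hy => ?_⟩
  have h : ∀ z ∈ Icc (0 : ℝ) 1, derivWithin (toReal _root_.id) (Icc 0 1) z = 1 := fun z hz => by
    rw [derivWithin_congr (f := fun w : ℝ => w) (fun w hw => toReal_id hw) (toReal_id hz)]
    exact derivWithin_id' _ _ (uniqueDiffOn_Icc zero_lt_one z hz)
  simp [h x hx, h y hy]

theorem IsC1Holder.bdd {α : ℝ} {f : I → I} (hf : IsC1Holder α f) :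
    ∃ B : ℝ, 0 ≤ B ∧ ∀ x ∈ Icc (0 : ℝ) 1, |derivWithin (toReal f) (Icc 0 1) x| ≤ B := by
  have hc := hf.1.continuousOn_derivWithin (uniqueDiffOn_Icc zero_lt_one) le_rfl
  obtain ⟨B, hB⟩ := isCompact_Icc.exists_bound_of_continuousOn hc
  exact ⟨B, (abs_nonneg _).trans (hB 0 (by simp)), hB⟩

theorem IsC1Holder.comp {α : ℝ} {f g : I → I} (hf : IsC1Holder α f) (hg : IsC1Holder α g) :
    IsC1Holder α (f ∘ g) := by
  have hu : UniqueDiffOn ℝ (Icc (0 : ℝ) 1) := uniqueDiffOn_Icc zero_lt_one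
  have hfd := hf.1.differentiableOn one_ne_zero
  have hgd := hg.1.differentiableOn one_ne_zero
  obtain ⟨A, hA0, hA⟩ := hf.bdd
  obtain ⟨B, hB0, hB⟩ := hg.bdd
  have hcd : ContDiffOn ℝ 1 (toReal (f ∘ g)) (Icc 0 1) := by
    rw [toReal_comp]
    exact hf.1.comp hg.1 (mapsTo_toReal g)
  have hder : ∀ x ∈ Icc (0 : ℝ) 1, derivWithin (toReal (f ∘ g)) (Icc 0 1) x =
      derivWithin (toReal f) (Icc 0 1) (toReal g x) * derivWithin (toReal g) (Icc 0 1) x := by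
    intro x hx
    rw [toReal_comp]
    exact derivWithin_comp x (hfd _ (mapsTo_toReal g hx)) (hgd x hx) (mapsTo_toReal g)
  refine ⟨hcd, ?_⟩
  rcases lt_or_ge α 0 with hα | hα
  · refine ⟨A * B + A * B, fun x hx y hy => ?_⟩
    rcases eq_or_ne x y with rfl | hxy
    · simp only [sub_self, abs_zero]
      exact mul_nonneg (by positivity) (Real.rpow_nonneg le_rfl _)
    have h1 : (1 : ℝ) ≤ |x - y| ^ α :=
      Real.one_le_rpow_of_pos_of_le_one_of_nonpos (abs_pos.2 (sub_ne_zero.2 hxy))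
        (abs_le.2 ⟨by linarith [hx.1, hy.2], by linarith [hx.2, hy.1]⟩) hα.le
    have h2 : ∀ z ∈ Icc (0 : ℝ) 1, |derivWithin (toReal (f ∘ g)) (Icc 0 1) z| ≤ A * B := by
      intro z hz
      rw [hder z hz, abs_mul]
      exact mul_le_mul (hA _ (mapsTo_toReal g hz)) (hB z hz) (abs_nonneg _) hA0
    calc _ ≤ A * B + A * B := (abs_sub _ _).trans (add_le_add (h2 x hx) (h2 y hy))
      _ ≤ _ := le_mul_of_one_le_right (by positivity) h1
  · obtain ⟨M, hM⟩ := hf.2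
    obtain ⟨N, hN⟩ := hg.2
    refine ⟨|M| * B ^ α * B + A * N, fun x hx y hy => ?_⟩
    have hlip : |toReal g x - toReal g y| ≤ B * |x - y| := by
      have := (convex_Icc (0 : ℝ) 1).norm_image_sub_le_of_norm_derivWithin_le hgd hB hy hx
      simpa using this
    have h1 : |derivWithin (toReal f) (Icc 0 1) (toReal g x) -
        derivWithin (toReal f) (Icc 0 1) (toReal g y)| ≤ |M| * B ^ α * |x - y| ^ α := by
      refine (hM _ (mapsTo_toReal g hx) _ (mapsTo_toReal g hy)).trans ?_
      rw [mul_assoc, ← Real.mul_rpow hB0 (abs_nonneg _)]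
      exact mul_le_mul (le_abs_self M) (Real.rpow_le_rpow (abs_nonneg _) hlip hα)
        (Real.rpow_nonneg (abs_nonneg _) _) (abs_nonneg _)
    rw [hder x hx, hder y hy]
    set a := derivWithin (toReal f) (Icc 0 1) (toReal g x)
    set b := derivWithin (toReal f) (Icc 0 1) (toReal g y)
    have hb : |b| ≤ A := hA _ (mapsTo_toReal g hy)
    set u := derivWithin (toReal g) (Icc 0 1) x
    set v := derivWithin (toReal g) (Icc 0 1) y
    have hR : 0 ≤ |x - y| ^ α := Real.rpow_nonneg (abs_nonneg _) _
    calc |a * u - b * v| = |(a - b) * u + b * (u - v)| := by ring_nf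
      _ ≤ |a - b| * |u| + |b| * |u - v| := by
        rw [← abs_mul, ← abs_mul]; exact abs_add_le _ _
      _ ≤ (|M| * B ^ α * |x - y| ^ α) * B + A * (N * |x - y| ^ α) := by
        refine add_le_add ?_ ?_
        · exact mul_le_mul h1 (hB x hx) (abs_nonneg _) (by positivity)
        · exact mul_le_mul hb (hN x hx y hy) (abs_nonneg _) hA0
      _ = _ := by ring

end HolderDiff

/-- The group `Diff_+^{1+α}([0,1])`, as a subgroup of the group of order isomorphisms (that is,
orientation preserving homeomorphisms) of `[0,1]` under composition: `f` and its inverse are both of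
class `C^{1+α}`. -/
def DiffPlus (α : ℝ) : Subgroup (I ≃o I) where
  carrier := {f | HolderDiff.IsC1Holder α f ∧ HolderDiff.IsC1Holder α f.symm}
  one_mem' := ⟨HolderDiff.IsC1Holder.id α, HolderDiff.IsC1Holder.id α⟩
  mul_mem' := fun ha hb => ⟨ha.1.comp hb.1, hb.2.comp ha.2⟩
  inv_mem' := fun ha => ⟨ha.2, ha.1⟩

/-- A group is metabelian if its second derived subgroup is trivial. -/
def IsMetabelian (G : Type*) [Group G] : Prop := derivedSeries G 2 = ⊥

/-- The number `1 / (|i|^p + |j|^q + 1)`; pairs `(i,j)` are ordered lexicographically. -/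
def blockLength (p q : ℝ) (n : ℤ ×ₗ ℤ) : ℝ :=
  1 / (|((ofLex n).1 : ℝ)| ^ p + |((ofLex n).2 : ℝ)| ^ q + 1)

/-- The sum of all the lengths. -/
def totalLength (p q : ℝ) : ℝ := ∑' n : ℤ ×ₗ ℤ, blockLength p q n

/-- The left endpoint of the interval with index `n`, once the intervals have been joined from left
to right in the lexicographic order and the result has been rescaled to `[0,1]`. -/
def blockLeft (p q : ℝ) (n : ℤ ×ₗ ℤ) : ℝ :=
  (∑' m : Iio n, blockLength p q m) / totalLength p q

/-- The closed interval `I_{i,j}` of `[0,1]`. -/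
def block (p q : ℝ) (i j : ℤ) : Set I :=
  {x | (x : ℝ) ∈ Icc (blockLeft p q (toLex (i, j)))
    (blockLeft p q (toLex (i, j)) + blockLength p q (toLex (i, j)) / totalLength p q)}

/-- The integer `r_k(i) = i (i+1) ⋯ (i+k-1) / k!`, with `r_0(i) = 1` (the division is exact). -/
def risingBinom (k : ℕ) (i : ℤ) : ℤ := (∏ m ∈ Finset.range k, (i + m)) / (k ! : ℤ)

theorem factorial_mul_risingBinom (k : ℕ) (i : ℤ) :
    (k ! : ℤ) * risingBinom k i = ∏ m ∈ Finset.range k, (i + m) := by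
  refine Int.mul_ediv_cancel' ⟨Ring.multichoose i k, ?_⟩
  have h := Ring.factorial_nsmul_multichoose_eq_ascPochhammer i k
  rw [← nsmul_eq_mul, h, Polynomial.ascPochhammer_smeval_eq_eval]
  clear h
  induction k with
  | zero => simp
  | succ k ih => rw [Finset.prod_range_succ, ih, ascPochhammer_succ_eval]

end

/-!
The maps `(i, t) ↦ (i + a, t + P i)` are automorphisms of `ℤ × ℝ` with the lexicographic order. The
commutator of the shear by `P` with the unit shift is the shear by `i ↦ P i - P (i - 1)`, and
`r_{k+1}(i) - r_{k+1}(i-1) = r_k(i)`; hence the shift and the shears by `r_0, …, r_{d-1}` generate a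
nilpotent group of class `d`, which is metabelian because shears commute.

To make this group act on `[0,1]`, each row `{i} × ℝ` is charted onto the interior of the union of
the `I_{i,j}` by a `C^2` map taking `[j, j + 1]` to `I_{i,j}`. The derivative `ρ_i` of this chart
interpolates between the lengths of neighbouring intervals. In the charts, the derivative of an
element of the group is the ratio of the densities `ρ` at the image and at the point, and it tends
to `1` at both ends of every row. It is `α`-Hölder once its difference from `1` and its derivative
along the row are small enough: the first bound settles distant points, an interpolation between
the two bounds settles close ones.

With `p = κ q`, and with `R_i = (1 + |i|)^κ` as the size of a row, `ρ_i(t)` is comparable to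
`(R_i + |t|)^{-q}`; differentiation in `t` gains a factor `(R_i + |t|)^{-1}`, and a difference
between rows a factor `(R_i + |t|)^{-1/κ}`. The shift is of class `C^{1+α}` when
`α (q - 1) = 1 / κ`, and for `κ` large so are the shears, as the polynomials `r_k` are then small
compared with `R_i`.
-/

noncomputable section

namespace HolderDiff

open Filter Topology Asymptotics
open scoped commutatorElement

section DenseExtension

variable {X : Type*} [LinearOrder X] {Y : Type*} [CompleteLinearOrder Y] {H : X → Y}

/-- The monotone extension along `H : X → Y` of an automorphism of `X`. -/
def denseExtend (H : X → Y) (Φ : X ≃o X) (y : Y) : Y := sSup {w | ∃ z, H z ≤ y ∧ H (Φ z) = w}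

theorem denseExtend_mono (H : X → Y) (Φ : X ≃o X) : Monotone (denseExtend H Φ) :=
  fun _ _ hxy => sSup_le_sSup fun _ ⟨z, hz, hw⟩ => ⟨z, hz.trans hxy, hw⟩

theorem denseExtend_apply (hH : StrictMono H) (Φ : X ≃o X) (z : X) :
    denseExtend H Φ (H z) = H (Φ z) := by
  refine le_antisymm (sSup_le ?_) (le_sSup ⟨z, le_rfl, rfl⟩)
  rintro _ ⟨w, hw, rfl⟩
  exact hH.monotone (Φ.monotone (hH.le_iff_le.1 hw))

theorem denseExtend_mul (hH : StrictMono H) (hdense : ∀ x y, x < y → ∃ z, x < H z ∧ H z < y)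
    (Φ Ψ : X ≃o X) (y : Y) :
    denseExtend H (Φ * Ψ) y = denseExtend H Φ (denseExtend H Ψ y) := by
  refine le_antisymm (sSup_le ?_) (sSup_le ?_)
  · rintro _ ⟨z, hz, rfl⟩
    exact le_sSup ⟨Ψ z, le_sSup ⟨z, hz, rfl⟩, rfl⟩
  · rintro _ ⟨w, hw, rfl⟩
    refine le_sSup ⟨Ψ.symm w, ?_, by simp [RelIso.mul_apply]⟩
    by_contra! hlt
    obtain ⟨z, hyz, hzw⟩ := hdense _ _ hlt
    have hwz : w ≤ Ψ z := hH.le_iff_le.1 <| hw.trans <|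
      (denseExtend_mono H Ψ hyz.le).trans_eq (denseExtend_apply hH Ψ z)
    exact hzw.not_ge (hH.monotone ((OrderIso.symm_apply_le Ψ).2 hwz))

theorem denseExtend_one (hdense : ∀ x y, x < y → ∃ z, x < H z ∧ H z < y) (y : Y) :
    denseExtend H 1 y = y := by
  refine le_antisymm (sSup_le ?_) ?_
  · rintro _ ⟨z, hz, rfl⟩
    exact hz
  · by_contra! hlt
    obtain ⟨z, hz, hzy⟩ := hdense _ _ hlt
    exact hz.not_ge (le_sSup ⟨z, hzy.le, rfl⟩)

/-- Automorphisms of a dense suborder extend to automorphisms of the completion. -/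
def denseExtendHom (hH : StrictMono H) (hdense : ∀ x y, x < y → ∃ z, x < H z ∧ H z < y) :
    (X ≃o X) →* (Y ≃o Y) where
  toFun Φ :=
    Equiv.toOrderIso
      { toFun := denseExtend H Φ
        invFun := denseExtend H Φ⁻¹
        left_inv := fun y => by
          rw [← denseExtend_mul hH hdense, inv_mul_cancel, denseExtend_one hdense]
        right_inv := fun y => by
          rw [← denseExtend_mul hH hdense, mul_inv_cancel, denseExtend_one hdense] }
      (denseExtend_mono H Φ) (denseExtend_mono H Φ⁻¹)
  map_one' := by
    ext y
    exact denseExtend_one hdense y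
  map_mul' Φ Ψ := by
    ext y
    exact denseExtend_mul hH hdense Φ Ψ y

theorem denseExtendHom_apply (hH : StrictMono H)
    (hdense : ∀ x y, x < y → ∃ z, x < H z ∧ H z < y) (Φ : X ≃o X) (z : X) :
    denseExtendHom hH hdense Φ (H z) = H (Φ z) :=
  denseExtend_apply hH Φ z

theorem denseExtendHom_injective (hH : StrictMono H)
    (hdense : ∀ x y, x < y → ∃ z, x < H z ∧ H z < y) :
    Function.Injective (denseExtendHom hH hdense) := by
  intro Φ Ψ h
  ext z
  apply hH.injective
  rw [← denseExtendHom_apply hH hdense, h, denseExtendHom_apply]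

end DenseExtension

section SubgroupSeries

variable {G G' : Type*} [Group G] [Group G']

theorem isMetabelian_iff (S : Subgroup G) : IsMetabelian S ↔ ⁅⁅S, S⁆, ⁅S, S⁆⁆ = ⊥ := by
  have hmap : (derivedSeries S 2).map S.subtype = ⁅⁅S, S⁆, ⁅S, S⁆⁆ := by
    simp only [derivedSeries_succ, derivedSeries_zero, Subgroup.map_commutator]
    rw [← MonoidHom.range_eq_map, Subgroup.range_subtype]
  rw [IsMetabelian, ← hmap, Subgroup.map_eq_bot_iff_of_injective _ S.subtype_injective]

theorem isMetabelian_map_iff {f : G →* G'} (hf : Function.Injective f) (S : Subgroup G) :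
    IsMetabelian (S.map f) ↔ IsMetabelian S := by
  rw [isMetabelian_iff, isMetabelian_iff, ← Subgroup.map_commutator, ← Subgroup.map_commutator,
    Subgroup.map_eq_bot_iff_of_injective _ hf]

theorem lowerCentralSeries_map_eq_bot_iff {f : G →* G'} (hf : Function.Injective f)
    (S : Subgroup G) (n : ℕ) :
    (S.map f).lowerCentralSeries n = ⊥ ↔ S.lowerCentralSeries n = ⊥ := by
  rw [← Subgroup.map_lowerCentralSeries, Subgroup.map_eq_bot_iff_of_injective _ hf]

theorem isNilpotent_and_nilpotencyClass_eq_succ {S : Subgroup G} {n : ℕ}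
    (hbot : S.lowerCentralSeries (n + 1) = ⊥) (hne : S.lowerCentralSeries n ≠ ⊥) :
    Group.IsNilpotent S ∧ Group.nilpotencyClass S = n + 1 := by
  have hS : Group.IsNilpotent S := Subgroup.isNilpotent_of_lowerCentralSeries_eq_bot hbot
  refine ⟨hS, le_antisymm ?_ ?_⟩
  · rw [← Subgroup.lowerCentralSeries_eq_bot_iff_nilpotencyClass_le,
      ← Subgroup.map_eq_bot_iff_of_injective _ S.subtype_injective,
      Subgroup.top_subtype_lowerCentralSeries, hbot]
  · by_contra! hlt
    exact hne (Subgroup.lowerCentralSeries_eq_bot_of_nilpotencyClass_le (Nat.lt_succ_iff.1 hlt))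

end SubgroupSeries

section Skew

/-- The automorphism `(i, t) ↦ (i + a, t + P i)` of `ℤ × ℝ` with the lexicographic order. -/
def skew (a : ℤ) (P : ℤ → ℤ) : (ℤ ×ₗ ℝ) ≃o (ℤ ×ₗ ℝ) where
  toFun z := toLex ((ofLex z).1 + a, (ofLex z).2 + P (ofLex z).1)
  invFun z := toLex ((ofLex z).1 - a, (ofLex z).2 - P ((ofLex z).1 - a))
  left_inv z := by simp
  right_inv z := by simp
  map_rel_iff' := by
    intro z w
    simp only [Equiv.coe_fn_mk, Prod.Lex.le_iff, ofLex_toLex, add_lt_add_iff_right,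
      add_left_inj]
    refine or_congr_right (and_congr_right fun h => ?_)
    rw [h, add_le_add_iff_right]

theorem skew_apply (a : ℤ) (P : ℤ → ℤ) (i : ℤ) (t : ℝ) :
    skew a P (toLex (i, t)) = toLex (i + a, t + P i) := rfl

theorem skew_mul (a b : ℤ) (P Q : ℤ → ℤ) :
    skew a P * skew b Q = skew (a + b) (fun i => Q i + P (i + b)) := by
  refine RelIso.ext fun z => ?_
  induction z using Lex.rec with | _ z
  rcases z with ⟨i, t⟩
  rw [RelIso.mul_apply, skew_apply, skew_apply, skew_apply]
  congr 2
  · ring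
  · push_cast; ring

theorem skew_zero_zero : skew 0 0 = 1 := by
  refine RelIso.ext fun z => ?_
  induction z using Lex.rec with | _ z
  rcases z with ⟨i, t⟩
  simp [skew_apply]

theorem skew_inv (a : ℤ) (P : ℤ → ℤ) : (skew a P)⁻¹ = skew (-a) (fun i => -P (i - a)) := by
  rw [inv_eq_iff_mul_eq_one, skew_mul, ← skew_zero_zero]
  congr 1
  · ring
  · funext i; simp [sub_eq_add_neg]

theorem skew_zero_right_inv (a : ℤ) : (skew a 0)⁻¹ = skew (-a) 0 :=
  (skew_inv a 0).trans (congrArg _ (funext fun _ => neg_zero))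

theorem skew_zero_left_inv (P : ℤ → ℤ) : (skew 0 P)⁻¹ = skew 0 (-P) := by
  simp only [skew_inv, neg_zero, sub_zero]
  rfl

theorem skew_zero_injective : Function.Injective (skew 0) := by
  intro P Q h
  funext i
  have := congrArg (fun Φ => (ofLex (Φ (toLex (i, (0 : ℝ))))).2) h
  simpa [skew_apply] using this

/-- Translation by `b`, acting on functions on `ℤ`. -/
def translate (b : ℤ) : Module.End ℤ (ℤ → ℤ) := LinearMap.funLeft ℤ ℤ (· + b)

theorem translate_apply (b : ℤ) (P : ℤ → ℤ) (i : ℤ) : translate b P i = P (i + b) := rfl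

theorem translate_zero : translate 0 = 1 :=
  LinearMap.ext fun P => funext fun i => by rw [translate_apply, add_zero, Module.End.one_apply]

theorem translate_commute (b c : ℤ) : Commute (translate b) (translate c) := by
  refine LinearMap.ext fun P => funext fun i => ?_
  simp only [Module.End.mul_apply, translate_apply, add_right_comm]

/-- The backward difference operator. -/
def bwdDiff : Module.End ℤ (ℤ → ℤ) := 1 - translate (-1)

theorem bwdDiff_apply (P : ℤ → ℤ) (i : ℤ) : bwdDiff P i = P i - P (i - 1) := rfl

theorem bwdDiff_pow_translate (n : ℕ) (b : ℤ) (P : ℤ → ℤ) :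
    (bwdDiff ^ n) (translate b P) = translate b ((bwdDiff ^ n) P) :=
  LinearMap.congr_fun
    (((Commute.one_left _).sub_left (translate_commute _ _)).pow_left n).eq P

theorem eq_const_of_bwdDiff_eq_zero {Q : ℤ → ℤ} (hQ : bwdDiff Q = 0) (i : ℤ) : Q i = Q 0 := by
  have hstep : ∀ i, Q i = Q (i - 1) := fun i => sub_eq_zero.1 (congrFun hQ i)
  induction i using Int.induction_on with
  | zero => rfl
  | succ i ih => rw [hstep, add_sub_cancel_right, ih]
  | pred i ih => rw [← hstep, ih]

theorem bwdDiff_pow_translate_of_succ {n : ℕ} {P : ℤ → ℤ} (hP : (bwdDiff ^ (n + 1)) P = 0)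
    (b : ℤ) : (bwdDiff ^ n) (translate b P) = (bwdDiff ^ n) P := by
  rw [pow_succ', Module.End.mul_apply] at hP
  rw [bwdDiff_pow_translate]
  funext i
  rw [translate_apply, eq_const_of_bwdDiff_eq_zero hP, eq_const_of_bwdDiff_eq_zero hP i]

/-- The transformations `(i, t) ↦ (i, t + P i)` where `P` is annihilated by the `n`-th
difference, that is, `P` is a polynomial of degree less than `n`. -/
def shears (n : ℕ) : Subgroup ((ℤ ×ₗ ℝ) ≃o (ℤ ×ₗ ℝ)) where
  carrier := {Φ | ∃ P : ℤ → ℤ, (bwdDiff ^ n) P = 0 ∧ Φ = skew 0 P}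
  one_mem' := ⟨0, map_zero _, skew_zero_zero.symm⟩
  mul_mem' := by
    rintro _ _ ⟨P, hP, rfl⟩ ⟨Q, hQ, rfl⟩
    refine ⟨Q + translate 0 P, ?_, skew_mul 0 0 P Q⟩
    rw [map_add, bwdDiff_pow_translate, hP, hQ, map_zero, add_zero]
  inv_mem' := by
    rintro _ ⟨P, hP, rfl⟩
    exact ⟨-P, by rw [map_neg, hP, neg_zero], skew_zero_left_inv P⟩

/-- The transformations `(i, t) ↦ (i + a, t + P i)` where `P` is annihilated by the `n`-th
difference. -/
def skews (n : ℕ) : Subgroup ((ℤ ×ₗ ℝ) ≃o (ℤ ×ₗ ℝ)) where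
  carrier := {Φ | ∃ (a : ℤ) (P : ℤ → ℤ), (bwdDiff ^ n) P = 0 ∧ Φ = skew a P}
  one_mem' := ⟨0, 0, map_zero _, skew_zero_zero.symm⟩
  mul_mem' := by
    rintro _ _ ⟨a, P, hP, rfl⟩ ⟨b, Q, hQ, rfl⟩
    refine ⟨a + b, Q + translate b P, ?_, skew_mul a b P Q⟩
    rw [map_add, bwdDiff_pow_translate, hP, hQ, map_zero, add_zero]
  inv_mem' := by
    rintro _ ⟨a, P, hP, rfl⟩
    refine ⟨-a, -translate (-a) P, ?_, skew_inv a P⟩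
    rw [map_neg, bwdDiff_pow_translate, hP, map_zero, neg_zero]

theorem commutator_skew (a b : ℤ) (P Q : ℤ → ℤ) :
    ⁅skew a P, skew b Q⁆ =
      skew 0 (translate (-a - b) (Q - translate a Q + (translate b P - P))) := by
  rw [commutatorElement_def, mul_inv_eq_iff_eq_mul, mul_inv_eq_iff_eq_mul, skew_mul, skew_mul,
    skew_mul]
  congr 1
  · ring
  · funext i
    simp only [translate_apply, Pi.add_apply, Pi.sub_apply]
    rw [show i + a + b + (-a - b) = i by ring]
    ring

theorem commutator_skews_le (n : ℕ) : ⁅skews (n + 1), skews (n + 1)⁆ ≤ shears n := by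
  rw [Subgroup.commutator_le]
  rintro _ ⟨a, P, hP, rfl⟩ _ ⟨b, Q, hQ, rfl⟩
  refine ⟨_, ?_, commutator_skew a b P Q⟩
  rw [bwdDiff_pow_translate, map_add, map_sub, map_sub, bwdDiff_pow_translate_of_succ hP,
    bwdDiff_pow_translate_of_succ hQ, sub_self, sub_self, add_zero, map_zero]

theorem commutator_shears_skews_le (n m : ℕ) : ⁅shears (n + 1), skews m⁆ ≤ shears n := by
  rw [Subgroup.commutator_le]
  rintro _ ⟨P, hP, rfl⟩ _ ⟨b, Q, -, rfl⟩
  refine ⟨_, ?_, commutator_skew 0 b P Q⟩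
  rw [bwdDiff_pow_translate, map_add, map_sub, map_sub, bwdDiff_pow_translate_of_succ hP,
    translate_zero, Module.End.one_apply, sub_self, sub_self, add_zero, map_zero]

theorem shears_zero : shears 0 = ⊥ := by
  rw [eq_bot_iff]
  rintro _ ⟨P, hP, rfl⟩
  rw [pow_zero, Module.End.one_apply] at hP
  rw [hP, skew_zero_zero]
  exact one_mem _

theorem commutator_shears_eq_bot (n : ℕ) : ⁅shears n, shears n⁆ = ⊥ := by
  rw [eq_bot_iff, Subgroup.commutator_le]
  rintro _ ⟨P, -, rfl⟩ _ ⟨Q, -, rfl⟩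
  rw [commutator_skew, translate_zero, Module.End.one_apply, Module.End.one_apply, sub_self,
    sub_self, add_zero, map_zero, skew_zero_zero]
  exact one_mem _

theorem lowerCentralSeries_skews_le {n m : ℕ} (hm : m ≤ n) :
    (skews (n + 1)).lowerCentralSeries (m + 1) ≤ shears (n - m) := by
  induction m with
  | zero => simpa using commutator_skews_le n
  | succ m ih =>
    rw [Subgroup.lowerCentralSeries_succ]
    refine (Subgroup.commutator_mono (ih (by omega)) le_rfl).trans ?_
    rw [show n - m = n - (m + 1) + 1 by omega]
    exact commutator_shears_skews_le _ _

theorem risingBinom_zero (i : ℤ) : risingBinom 0 i = 1 := by simp [risingBinom]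

theorem bwdDiff_risingBinom_succ (k : ℕ) : bwdDiff (risingBinom (k + 1)) = risingBinom k := by
  funext i
  have hfact : ((k + 1)! : ℤ) = (k + 1) * k ! := by push_cast [Nat.factorial_succ]; ring
  have hprod : ∏ m ∈ Finset.range k, (i - 1 + ((m + 1 : ℕ) : ℤ)) =
      ∏ m ∈ Finset.range k, (i + m) :=
    Finset.prod_congr rfl fun m _ => by push_cast; ring
  apply mul_left_cancel₀ (show ((k + 1)! : ℤ) ≠ 0 by exact_mod_cast Nat.factorial_ne_zero _)
  rw [bwdDiff_apply, mul_sub, factorial_mul_risingBinom, factorial_mul_risingBinom, hfact,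
    mul_assoc, factorial_mul_risingBinom, Finset.prod_range_succ, Finset.prod_range_succ', hprod]
  push_cast
  ring

theorem bwdDiff_pow_risingBinom {k n : ℕ} (hkn : k < n) : (bwdDiff ^ n) (risingBinom k) = 0 := by
  induction k generalizing n with
  | zero =>
    obtain ⟨n, rfl⟩ := Nat.exists_eq_succ_of_ne_zero hkn.ne'
    have hconst : bwdDiff (risingBinom 0) = 0 := by
      funext i
      simp [bwdDiff_apply, risingBinom_zero]
    rw [pow_succ, Module.End.mul_apply, hconst, map_zero]
  | succ k ih =>
    obtain ⟨n, rfl⟩ := Nat.exists_eq_succ_of_ne_zero (Nat.ne_zero_of_lt hkn)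
    rw [pow_succ, Module.End.mul_apply, bwdDiff_risingBinom_succ, ih (Nat.succ_lt_succ_iff.1 hkn)]

/-- The group generated by `(i, t) ↦ (i + 1, t)` and `(i, t) ↦ (i, t + r_k(i))` for `k < d`. -/
def modelGroup (d : ℕ) : Subgroup ((ℤ ×ₗ ℝ) ≃o (ℤ ×ₗ ℝ)) :=
  Subgroup.closure (insert (skew 1 0) (range fun k : Fin d => skew 0 (risingBinom k)))

theorem modelGroup_le_skews (d : ℕ) : modelGroup d ≤ skews d := by
  rw [modelGroup, Subgroup.closure_le, insert_subset_iff]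
  refine ⟨⟨1, 0, map_zero _, rfl⟩, ?_⟩
  rintro _ ⟨k, rfl⟩
  exact ⟨0, _, bwdDiff_pow_risingBinom k.2, rfl⟩

theorem isMetabelian_modelGroup (n : ℕ) : IsMetabelian (modelGroup (n + 1)) := by
  have hle := (Subgroup.commutator_mono (modelGroup_le_skews (n + 1))
    (modelGroup_le_skews (n + 1))).trans (commutator_skews_le n)
  rw [isMetabelian_iff, eq_bot_iff, ← commutator_shears_eq_bot n]
  exact Subgroup.commutator_mono hle hle

theorem lowerCentralSeries_modelGroup_eq_bot (n : ℕ) :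
    (modelGroup (n + 1)).lowerCentralSeries (n + 1) = ⊥ := by
  rw [eq_bot_iff, ← shears_zero]
  refine (Subgroup.lowerCentralSeries_mono (n + 1) (modelGroup_le_skews (n + 1))).trans ?_
  simpa using lowerCentralSeries_skews_le (le_refl n)

theorem commutator_skew_risingBinom (k : ℕ) :
    ⁅skew 0 (risingBinom (k + 1)), skew 1 0⁆ = skew 0 (risingBinom k) := by
  rw [commutator_skew, ← bwdDiff_risingBinom_succ k]
  congr 1
  funext i
  simp [translate_apply, bwdDiff_apply, sub_eq_add_neg]

theorem skew_risingBinom_mem_lowerCentralSeries {n k : ℕ} (hk : k ≤ n) :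
    skew 0 (risingBinom (n - k)) ∈ (modelGroup (n + 1)).lowerCentralSeries k := by
  induction k with
  | zero => exact Subgroup.subset_closure (mem_insert_of_mem _ ⟨Fin.last n, rfl⟩)
  | succ k ih =>
    have hshift : skew 1 0 ∈ modelGroup (n + 1) := Subgroup.subset_closure (mem_insert _ _)
    have hmem := Subgroup.commutator_mem_commutator (ih (by omega)) hshift
    rwa [show n - k = n - (k + 1) + 1 by omega, commutator_skew_risingBinom] at hmem

theorem lowerCentralSeries_modelGroup_ne_bot (n : ℕ) :
    (modelGroup (n + 1)).lowerCentralSeries n ≠ ⊥ := by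
  intro hbot
  have hmem := skew_risingBinom_mem_lowerCentralSeries (le_refl n)
  rw [hbot, Subgroup.mem_bot, ← skew_zero_zero] at hmem
  simpa [risingBinom_zero] using congrFun (skew_zero_injective hmem) 0

end Skew

section Glue

/-- The function on `ℝ` given by `c n` on `[n, n + 1)`, in the coordinate `t - n`. -/
def glue (c : ℤ → ℝ → ℝ) (t : ℝ) : ℝ := c ⌊t⌋ (Int.fract t)

theorem glue_intCast (c : ℤ → ℝ → ℝ) (n : ℤ) : glue c n = c n 0 := by
  rw [glue, Int.floor_intCast, Int.fract_intCast]

theorem glue_eq {c : ℤ → ℝ → ℝ} (hc : ∀ n, c n 1 = c (n + 1) 0) {n : ℤ} {t : ℝ}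
    (ht : t ∈ Icc (n : ℝ) (n + 1)) : glue c t = c n (t - n) := by
  rcases ht.2.lt_or_eq with hlt | rfl
  · rw [glue, Int.fract, Int.floor_eq_iff.2 ⟨ht.1, hlt⟩]
  · rw [add_sub_cancel_left, hc, ← glue_intCast c (n + 1), Int.cast_add, Int.cast_one]

theorem hasDerivWithinAt_glue {c c' : ℤ → ℝ → ℝ} (hc : ∀ n, c n 1 = c (n + 1) 0)
    (hc' : ∀ n, c' n 1 = c' (n + 1) 0) (hderiv : ∀ n s, HasDerivAt (c n) (c' n s) s) {n : ℤ}
    {t : ℝ} (ht : t ∈ Icc (n : ℝ) (n + 1)) :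
    HasDerivWithinAt (glue c) (glue c' t) (Icc (n : ℝ) (n + 1)) t := by
  rw [glue_eq hc' ht]
  exact ((hderiv n (t - n)).comp_sub_const t n).hasDerivWithinAt.congr
    (fun x hx => glue_eq hc hx) (glue_eq hc ht)

theorem hasDerivAt_glue {c c' : ℤ → ℝ → ℝ} (hc : ∀ n, c n 1 = c (n + 1) 0)
    (hc' : ∀ n, c' n 1 = c' (n + 1) 0) (hderiv : ∀ n s, HasDerivAt (c n) (c' n s) s) (t : ℝ) :
    HasDerivAt (glue c) (glue c' t) t := by
  have hright : HasDerivWithinAt (glue c) (glue c' t) (Ici t) t := by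
    refine (hasDerivWithinAt_glue hc hc' hderiv
      ⟨Int.floor_le t, (Int.lt_floor_add_one t).le⟩).mono_of_mem_nhdsWithin ?_
    exact mem_of_superset (Icc_mem_nhdsGE (Int.lt_floor_add_one t))
      (Icc_subset_Icc_left (Int.floor_le t))
  have hleft : HasDerivWithinAt (glue c) (glue c' t) (Iic t) t := by
    have hlt : ((⌈t⌉ - 1 : ℤ) : ℝ) < t := by
      push_cast; linarith [Int.ceil_lt_add_one t]
    have hle : t ≤ ((⌈t⌉ - 1 : ℤ) : ℝ) + 1 := by
      push_cast; linarith [Int.le_ceil t]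
    refine (hasDerivWithinAt_glue hc hc' hderiv ⟨hlt.le, hle⟩).mono_of_mem_nhdsWithin ?_
    exact mem_of_superset (Icc_mem_nhdsLE hlt) (Icc_subset_Icc_right hle)
  simpa only [Iic_union_Ici, hasDerivWithinAt_univ] using hleft.union hright

theorem isBigO_mul_of_isBigO_one {ι : Type*} {l : Filter ι} {f g h : ι → ℝ} (hf : f =O[l] g)
    (hh : h =O[l] fun _ => (1 : ℝ)) : (fun x => f x * h x) =O[l] g := by
  simpa only [mul_one] using hf.mul hh

theorem isBigO_comp_fract {ι : Type*} {l : Filter ι} {f : ℝ → ℝ} (hf : Continuous f)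
    (t : ι → ℝ) : (fun x => f (Int.fract (t x))) =O[l] fun _ => (1 : ℝ) := by
  obtain ⟨B, hB⟩ :=
    isCompact_Icc.exists_bound_of_continuousOn (s := Icc (0 : ℝ) 1) hf.continuousOn
  exact .of_bound B (.of_forall fun x => by
    simpa using hB _ ⟨Int.fract_nonneg (t x), (Int.fract_lt_one (t x)).le⟩)

end Glue

section Interpolation

/-- The weight of a neighbouring value in the interpolation of a sequence by a density. It is the
cubic polynomial with value `1 / 2` at `0`, a double zero at `1` and integral zero over `[0, 1]`. -/
def weight (s : ℝ) : ℝ := (1 - s) ^ 2 * (1 - 4 * s) / 2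

/-- The derivative of `weight`. -/
def weightDeriv (s : ℝ) : ℝ := -3 * (1 - s) * (1 - 2 * s)

/-- The primitive of `weight`. -/
def weightPrim (s : ℝ) : ℝ := s * (1 - s) ^ 3 / 2

theorem hasDerivAt_weight (s : ℝ) : HasDerivAt weight (weightDeriv s) s := by
  have hsub : HasDerivAt (fun x : ℝ => 1 - x) (-1) s := by
    simpa using (hasDerivAt_id s).const_sub 1
  have hsub4 : HasDerivAt (fun x : ℝ => 1 - 4 * x) (-4) s := by
    simpa using ((hasDerivAt_id s).const_mul 4).const_sub 1
  refine (((hsub.pow 2).mul hsub4).div_const 2).congr_deriv ?_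
  simp only [weightDeriv, Pi.pow_apply, Nat.cast_ofNat, Nat.reduceSub, pow_one]
  ring

theorem hasDerivAt_weightPrim (s : ℝ) : HasDerivAt weightPrim (weight s) s := by
  have hsub : HasDerivAt (fun x : ℝ => 1 - x) (-1) s := by
    simpa using (hasDerivAt_id s).const_sub 1
  refine (((hasDerivAt_id s).mul (hsub.pow 3)).div_const 2).congr_deriv ?_
  simp only [weight, Pi.pow_apply, id_eq, Nat.cast_ofNat, Nat.reduceSub]
  ring

theorem continuous_weight : Continuous weight := by
  unfold weight
  fun_prop

theorem continuous_weightDeriv : Continuous weightDeriv := by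
  unfold weightDeriv
  fun_prop

theorem neg_le_weight {s : ℝ} (hs : s ≤ 1) : -(s * (1 - s) / 2) ≤ weight s := by
  have heq : weight s + s * (1 - s) / 2 = (1 - s) * (1 - 2 * s) ^ 2 / 2 := by
    rw [weight]; ring
  have hnonneg := mul_nonneg (sub_nonneg.2 hs) (sq_nonneg (1 - 2 * s))
  linarith

/-- A `C^1` density on `ℝ` whose integral over each `[n, n + 1]` is `v n`. -/
def density (v : ℤ → ℝ) : ℝ → ℝ :=
  glue fun n s => v n + (v (n - 1) - v n) * weight s + (v (n + 1) - v n) * weight (1 - s)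

/-- The derivative of `density`. -/
def densityDeriv (v : ℤ → ℝ) : ℝ → ℝ :=
  glue fun n s => (v (n - 1) - v n) * weightDeriv s - (v (n + 1) - v n) * weightDeriv (1 - s)

/-- The primitive of `density v` with prescribed values `b n` at the integers. -/
def densityPrim (b v : ℤ → ℝ) : ℝ → ℝ :=
  glue fun n s => b n +
    (v n * s + (v (n - 1) - v n) * weightPrim s - (v (n + 1) - v n) * weightPrim (1 - s))

theorem hasDerivAt_density (v : ℤ → ℝ) (t : ℝ) :
    HasDerivAt (density v) (densityDeriv v t) t := by
  refine hasDerivAt_glue (fun n => ?_) (fun n => ?_) (fun n s => ?_) t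
  · rw [add_sub_cancel_right]
    norm_num [weight]
    ring
  · rw [add_sub_cancel_right]
    norm_num [weightDeriv]
    ring
  · have hrefl : HasDerivAt (fun x : ℝ => weight (1 - x)) (-weightDeriv (1 - s)) s := by
      simpa using (hasDerivAt_weight (1 - s)).comp_const_sub 1 s
    refine ((((hasDerivAt_weight s).const_mul _).const_add _).add
      (hrefl.const_mul _)).congr_deriv ?_
    ring

theorem hasDerivAt_densityPrim {b v : ℤ → ℝ} (hb : ∀ n, b (n + 1) = b n + v n) (t : ℝ) :
    HasDerivAt (densityPrim b v) (density v t) t := by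
  refine hasDerivAt_glue (fun n => ?_) (fun n => ?_) (fun n s => ?_) t
  · rw [hb]
    norm_num [weightPrim]
  · rw [add_sub_cancel_right]
    norm_num [weight]
    ring
  · have hrefl : HasDerivAt (fun x : ℝ => weightPrim (1 - x)) (-weight (1 - s)) s := by
      simpa using (hasDerivAt_weightPrim (1 - s)).comp_const_sub 1 s
    refine (((((hasDerivAt_id s).const_mul _).add ((hasDerivAt_weightPrim s).const_mul _)).sub
      (hrefl.const_mul _)).const_add _).congr_deriv ?_
    ring

theorem densityPrim_intCast (b v : ℤ → ℝ) (n : ℤ) : densityPrim b v n = b n := by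
  rw [densityPrim, glue_intCast]
  norm_num [weightPrim]

theorem density_sub (v w : ℤ → ℝ) (t : ℝ) : density (v - w) t = density v t - density w t := by
  simp only [density, glue, Pi.sub_apply]
  ring

theorem densityDeriv_sub (v w : ℤ → ℝ) (t : ℝ) :
    densityDeriv (v - w) t = densityDeriv v t - densityDeriv w t := by
  simp only [densityDeriv, glue, Pi.sub_apply]
  ring

theorem half_le_density {v : ℤ → ℝ} {t : ℝ} (hnonneg : ∀ n, 0 ≤ v n)
    (hpred : v (⌊t⌋ - 1) ≤ 3 * v ⌊t⌋) (hsucc : v (⌊t⌋ + 1) ≤ 3 * v ⌊t⌋) :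
    v ⌊t⌋ / 2 ≤ density v t := by
  have hs0 := Int.fract_nonneg t
  have hs1 := (Int.fract_lt_one t).le
  rw [density, glue]
  generalize Int.fract t = s at *
  generalize ⌊t⌋ = n at *
  have hs : 0 ≤ s * (1 - s) := mul_nonneg hs0 (sub_nonneg.2 hs1)
  have heq : v n + (v (n - 1) - v n) * weight s + (v (n + 1) - v n) * weight (1 - s) =
      v n * (1 / 2 + 3 * (s * (1 - s))) + v (n - 1) * weight s + v (n + 1) * weight (1 - s) := by
    simp only [weight]; ring
  have hweight_pred := mul_le_mul_of_nonneg_left (neg_le_weight hs1) (hnonneg (n - 1))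
  have hweight_succ := mul_le_mul_of_nonneg_left (neg_le_weight (s := 1 - s) (by linarith))
    (hnonneg (n + 1))
  have hpred' := mul_le_mul_of_nonneg_right hpred hs
  have hsucc' := mul_le_mul_of_nonneg_right hsucc hs
  rw [heq]
  nlinarith

variable {ι : Type*} {l : Filter ι} {v : ι → ℤ → ℝ} {t g : ι → ℝ}

theorem isBigO_density
    (hv : ∀ e : ℤ, |e| ≤ 1 → (fun x => v x (⌊t x⌋ + e)) =O[l] g) :
    (fun x => density (v x) (t x)) =O[l] g := by
  have hpred := hv (-1) (by simp)
  have hzero := hv 0 (by simp)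
  have hsucc := hv 1 (by simp)
  simp only [add_zero, ← sub_eq_add_neg] at hpred hzero
  have hw := isBigO_comp_fract (l := l) continuous_weight t
  have hw' : (fun x => weight (1 - Int.fract (t x))) =O[l] fun _ => (1 : ℝ) :=
    isBigO_comp_fract (continuous_weight.comp (continuous_sub_left 1)) t
  exact (hzero.add (isBigO_mul_of_isBigO_one (hpred.sub hzero) hw)).add
    (isBigO_mul_of_isBigO_one (hsucc.sub hzero) hw')

theorem isBigO_densityDeriv
    (hv : ∀ e : ℤ, |e| ≤ 1 → (fun x => v x (⌊t x⌋ + e + 1) - v x (⌊t x⌋ + e)) =O[l] g) :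
    (fun x => densityDeriv (v x) (t x)) =O[l] g := by
  have hpred := (hv (-1) (by simp)).neg_left
  have hsucc := hv 0 (by simp)
  simp only [add_zero, ← sub_eq_add_neg, sub_add_cancel, neg_sub] at hpred hsucc
  have hw := isBigO_comp_fract (l := l) continuous_weightDeriv t
  have hw' : (fun x => weightDeriv (1 - Int.fract (t x))) =O[l] fun _ => (1 : ℝ) :=
    isBigO_comp_fract (continuous_weightDeriv.comp (continuous_sub_left 1)) t
  exact (isBigO_mul_of_isBigO_one hpred hw).sub (isBigO_mul_of_isBigO_one hsucc hw')

end Interpolation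

section LeftEnd

variable {ι : Type*} {v : ι → ℝ}

theorem tsum_subtype_mono (hpos : ∀ n, 0 ≤ v n) (hsum : Summable v) {A B : Set ι} (hAB : A ⊆ B) :
    ∑' m : A, v m ≤ ∑' m : B, v m := by
  rw [tsum_subtype, tsum_subtype]
  exact (hsum.indicator A).tsum_le_tsum (indicator_le_indicator_of_subset hAB hpos)
    (hsum.indicator B)

variable [LinearOrder ι]

/-- The left endpoint of the interval with index `n`, when intervals of lengths `v m` are joined
from left to right in the order of their indices, starting from `0`. -/
def leftEnd (v : ι → ℝ) (n : ι) : ℝ := ∑' m : Iio n, v m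

theorem leftEnd_nonneg (hpos : ∀ n, 0 ≤ v n) (n : ι) : 0 ≤ leftEnd v n :=
  tsum_nonneg fun _ => hpos _

theorem tsum_Iic_eq (hsum : Summable v) (n : ι) : ∑' m : Iic n, v m = leftEnd v n + v n := by
  rw [← tsum_singleton n v, leftEnd, ← (hsum.subtype _).tsum_union_disjoint (by simp)
    (hsum.subtype _), Iio_union_right]

theorem leftEnd_eq_of_covBy (hsum : Summable v) {n m : ι} (hnm : n ⋖ m) :
    leftEnd v m = leftEnd v n + v n := by
  rw [← tsum_Iic_eq hsum, leftEnd, hnm.Iio_eq]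

theorem leftEnd_add_le_leftEnd (hpos : ∀ n, 0 ≤ v n) (hsum : Summable v) {n m : ι}
    (hnm : n < m) : leftEnd v n + v n ≤ leftEnd v m := by
  rw [← tsum_Iic_eq hsum]
  exact tsum_subtype_mono hpos hsum (Iic_subset_Iio.2 hnm)

theorem sum_le_leftEnd_add (hpos : ∀ n, 0 ≤ v n) (hsum : Summable v) {s : Finset ι} {n : ι}
    (hs : ∀ m ∈ s, m ≤ n) : ∑ m ∈ s, v m ≤ leftEnd v n + v n := by
  rw [← tsum_Iic_eq hsum, ← Finset.tsum_subtype']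
  exact tsum_subtype_mono hpos hsum hs

theorem leftEnd_add_sum_le_tsum (hpos : ∀ n, 0 ≤ v n) (hsum : Summable v) {s : Finset ι} {n : ι}
    (hs : ∀ m ∈ s, n ≤ m) : leftEnd v n + ∑ m ∈ s, v m ≤ ∑' m, v m := by
  have hdisj : Disjoint (Iio n) (s : Set ι) :=
    disjoint_left.2 fun m hmn hms => (hs m hms).not_gt hmn
  rw [← Finset.tsum_subtype', leftEnd, ← tsum_univ v,
    ← (hsum.subtype _).tsum_union_disjoint hdisj (hsum.subtype _)]
  exact tsum_subtype_mono hpos hsum (subset_univ _)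

theorem leftEnd_add_le_tsum (hpos : ∀ n, 0 ≤ v n) (hsum : Summable v) (n : ι) :
    leftEnd v n + v n ≤ ∑' m, v m := by
  simpa using leftEnd_add_sum_le_tsum hpos hsum (s := {n}) (n := n) (by simp)

theorem exists_lt_leftEnd_add_and_leftEnd_lt (hpos : ∀ n, 0 ≤ v n) (hsum : Summable v) {x y : ℝ}
    (hx : 0 ≤ x) (hxy : x < y) (hy : y ≤ ∑' m, v m) :
    ∃ n, x < leftEnd v n + v n ∧ leftEnd v n < y := by
  by_contra! hno
  have hleft : ∀ s : Finset ι, (∀ m ∈ s, leftEnd v m + v m ≤ x) → ∑ m ∈ s, v m ≤ x := by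
    intro s hs
    rcases s.eq_empty_or_nonempty with rfl | hne
    · simpa using hx
    · exact (sum_le_leftEnd_add hpos hsum fun m => s.le_max' m).trans (hs _ (s.max'_mem hne))
  have hright : ∀ s : Finset ι, (∀ m ∈ s, y ≤ leftEnd v m) →
      y + ∑ m ∈ s, v m ≤ ∑' m, v m := by
    intro s hs
    rcases s.eq_empty_or_nonempty with rfl | hne
    · simpa using hy
    · exact (add_le_add_left (hs _ (s.min'_mem hne)) _).trans
        (leftEnd_add_sum_le_tsum hpos hsum fun m => s.min'_le m)
  have htotal : ∑' m, v m ≤ x + (∑' m, v m - y) := by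
    refine hsum.tsum_le_of_sum_le fun s => ?_
    rw [← Finset.sum_filter_add_sum_filter_not s fun n => leftEnd v n + v n ≤ x]
    refine add_le_add (hleft _ fun m hm => (Finset.mem_filter.1 hm).2) (le_sub_iff_add_le'.2
      (hright _ fun m hm => ?_))
    exact hno m (not_le.1 (Finset.mem_filter.1 hm).2)
  linarith

end LeftEnd

/-- A positive summable family of lengths of total mass one, in which the lengths of adjacent
intervals of a row are comparable; adjacency of indices is `|k - j| ≤ 1`. -/
structure IsSubdivision (v : ℤ ×ₗ ℤ → ℝ) : Prop where
  pos : ∀ n, 0 < v n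
  hasSum : HasSum v 1
  le_three_mul : ∀ i j k : ℤ, |k - j| ≤ 1 → v (toLex (i, k)) ≤ 3 * v (toLex (i, j))

/-- The `C^1` density in the `i`-th row. -/
def rho (v : ℤ ×ₗ ℤ → ℝ) (i : ℤ) : ℝ → ℝ := density fun j => v (toLex (i, j))

/-- The derivative of `rho v i`. -/
def rhoDeriv (v : ℤ ×ₗ ℤ → ℝ) (i : ℤ) : ℝ → ℝ := densityDeriv fun j => v (toLex (i, j))

/-- The parametrization of the `i`-th row by `ℝ`, sending `[j, j + 1]` to the interval with
index `(i, j)`. -/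
def chart (v : ℤ ×ₗ ℤ → ℝ) (i : ℤ) : ℝ → ℝ :=
  densityPrim (fun j => leftEnd v (toLex (i, j))) fun j => v (toLex (i, j))

/-- The embedding of `ℤ × ℝ` in `[0,1]` given by the parametrizations of the rows. -/
def embed (v : ℤ ×ₗ ℤ → ℝ) (z : ℤ ×ₗ ℝ) : I :=
  projIcc 0 1 zero_le_one (chart v (ofLex z).1 (ofLex z).2)

theorem toLex_covBy_toLex_add_one (i j : ℤ) : toLex (i, j) ⋖ toLex (i, j + 1) := by
  refine ⟨Prod.Lex.toLex_lt_toLex.2 (Or.inr ⟨rfl, lt_add_one j⟩), fun m hlt hgt => ?_⟩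
  induction m using Lex.rec with | _ m
  rw [Prod.Lex.toLex_lt_toLex] at hlt hgt
  dsimp only at hlt hgt
  omega

section Chart

variable {v : ℤ ×ₗ ℤ → ℝ}

theorem hasDerivAt_rho (v : ℤ ×ₗ ℤ → ℝ) (i : ℤ) (t : ℝ) :
    HasDerivAt (rho v i) (rhoDeriv v i t) t := hasDerivAt_density _ t

theorem continuous_rho (v : ℤ ×ₗ ℤ → ℝ) (i : ℤ) : Continuous (rho v i) :=
  continuous_iff_continuousAt.2 fun t => (hasDerivAt_rho v i t).continuousAt

theorem chart_intCast (v : ℤ ×ₗ ℤ → ℝ) (i j : ℤ) : chart v i j = leftEnd v (toLex (i, j)) :=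
  densityPrim_intCast _ _ j

namespace IsSubdivision

variable (hv : IsSubdivision v)
include hv

theorem summable : Summable v := hv.hasSum.summable

theorem nonneg (n : ℤ ×ₗ ℤ) : 0 ≤ v n := (hv.pos n).le

theorem leftEnd_succ (i j : ℤ) :
    leftEnd v (toLex (i, j + 1)) = leftEnd v (toLex (i, j)) + v (toLex (i, j)) :=
  leftEnd_eq_of_covBy hv.summable (toLex_covBy_toLex_add_one i j)

theorem half_le_rho (i : ℤ) (t : ℝ) : v (toLex (i, ⌊t⌋)) / 2 ≤ rho v i t :=
  half_le_density (v := fun j => v (toLex (i, j))) (fun _ => hv.nonneg _)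
    (hv.le_three_mul i _ _ (by simp)) (hv.le_three_mul i _ _ (by simp))

theorem rho_pos (i : ℤ) (t : ℝ) : 0 < rho v i t :=
  (half_pos (hv.pos _)).trans_le (hv.half_le_rho i t)

theorem hasDerivAt_chart (i : ℤ) (t : ℝ) : HasDerivAt (chart v i) (rho v i t) t :=
  hasDerivAt_densityPrim (b := fun j => leftEnd v (toLex (i, j)))
    (v := fun j => v (toLex (i, j))) (hv.leftEnd_succ i) t

theorem continuous_chart (i : ℤ) : Continuous (chart v i) :=
  continuous_iff_continuousAt.2 fun t => (hv.hasDerivAt_chart i t).continuousAt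

theorem chart_strictMono (i : ℤ) : StrictMono (chart v i) :=
  strictMono_of_hasDerivAt_pos (hv.hasDerivAt_chart i) (hv.rho_pos i)

theorem leftEnd_le_chart (i : ℤ) (t : ℝ) : leftEnd v (toLex (i, ⌊t⌋)) ≤ chart v i t := by
  rw [← chart_intCast]
  exact (hv.chart_strictMono i).monotone (Int.floor_le t)

theorem chart_lt (i : ℤ) (t : ℝ) :
    chart v i t < leftEnd v (toLex (i, ⌊t⌋)) + v (toLex (i, ⌊t⌋)) := by
  rw [← hv.leftEnd_succ, ← chart_intCast]
  exact hv.chart_strictMono i (by exact_mod_cast Int.lt_floor_add_one t)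

theorem chart_mem_Ioo (i : ℤ) (t : ℝ) : chart v i t ∈ Ioo (0 : ℝ) 1 :=
  ⟨((leftEnd_nonneg hv.nonneg _).trans (hv.leftEnd_le_chart i (t - 1))).trans_lt
      (hv.chart_strictMono i (sub_one_lt t)),
    (hv.chart_lt i t).trans_le (hv.hasSum.tsum_eq ▸ leftEnd_add_le_tsum hv.nonneg hv.summable _)⟩

theorem chart_lt_chart {i k : ℤ} (hik : i < k) (s t : ℝ) : chart v i s < chart v k t :=
  (hv.chart_lt i s).trans_le ((leftEnd_add_le_leftEnd hv.nonneg hv.summable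
    (Prod.Lex.toLex_lt_toLex.2 (Or.inl hik))).trans (hv.leftEnd_le_chart k t))

theorem exists_chart_eq {i j : ℤ} {x : ℝ}
    (hx : x ∈ Icc (leftEnd v (toLex (i, j))) (leftEnd v (toLex (i, j)) + v (toLex (i, j)))) :
    ∃ t, chart v i t = x := by
  rw [← hv.leftEnd_succ, ← chart_intCast, ← chart_intCast] at hx
  obtain ⟨t, -, ht⟩ := intermediate_value_Icc (Int.cast_le.2 (Int.le_add_one le_rfl))
    (hv.continuous_chart i).continuousOn hx
  exact ⟨t, ht⟩

theorem exists_chart_between {x y : ℝ} (hx : 0 ≤ x) (hxy : x < y) (hy : y ≤ 1) :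
    ∃ i t, x < chart v i t ∧ chart v i t < y := by
  obtain ⟨n, hxn, hny⟩ := exists_lt_leftEnd_add_and_leftEnd_lt hv.nonneg hv.summable hx hxy
    (hv.hasSum.tsum_eq.symm ▸ hy)
  obtain ⟨z, hz, hz'⟩ := exists_between
    (max_lt (lt_min hxy hxn) (lt_min hny (lt_add_of_pos_right _ (hv.pos n))))
  rw [max_lt_iff] at hz
  rw [lt_min_iff] at hz'
  obtain ⟨t, rfl⟩ := hv.exists_chart_eq (i := (ofLex n).1) (j := (ofLex n).2) ⟨hz.2.le, hz'.2.le⟩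
  exact ⟨_, t, hz.1, hz'.1⟩

theorem coe_embed (i : ℤ) (t : ℝ) : (embed v (toLex (i, t)) : ℝ) = chart v i t := by
  rw [embed, projIcc_of_mem _ (Ioo_subset_Icc_self (hv.chart_mem_Ioo _ _))]
  rfl

theorem embed_strictMono : StrictMono (embed v) := by
  intro z w hzw
  induction z using Lex.rec with | _ z
  induction w using Lex.rec with | _ w
  rcases z with ⟨i, t⟩
  rcases w with ⟨k, s⟩
  rw [← Subtype.coe_lt_coe, hv.coe_embed, hv.coe_embed]
  rcases Prod.Lex.toLex_lt_toLex.1 hzw with hik | ⟨rfl, hts⟩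
  · exact hv.chart_lt_chart hik t s
  · exact hv.chart_strictMono _ hts

theorem exists_embed_between (x y : I) (hxy : x < y) : ∃ z, x < embed v z ∧ embed v z < y := by
  obtain ⟨i, t, hxt, hty⟩ := hv.exists_chart_between x.2.1 hxy y.2.2
  exact ⟨toLex (i, t), by rwa [← Subtype.coe_lt_coe, hv.coe_embed],
    by rwa [← Subtype.coe_lt_coe, hv.coe_embed]⟩

end IsSubdivision

/-- The action on `[0,1]` of the automorphisms of `ℤ × ℝ`. -/
def IsSubdivision.action (hv : IsSubdivision v) : ((ℤ ×ₗ ℝ) ≃o (ℤ ×ₗ ℝ)) →* (I ≃o I) :=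
  denseExtendHom hv.embed_strictMono hv.exists_embed_between

namespace IsSubdivision

variable (hv : IsSubdivision v)

theorem action_injective : Function.Injective hv.action :=
  denseExtendHom_injective _ _

theorem action_embed (a : ℤ) (P : ℤ → ℤ) (i : ℤ) (t : ℝ) :
    hv.action (skew a P) (embed v (toLex (i, t))) = embed v (toLex (i + a, t + P i)) :=
  denseExtendHom_apply _ _ _ _

theorem action_image_Icc (a : ℤ) (P : ℤ → ℤ) (i j : ℤ) :
    hv.action (skew a P) '' Icc (embed v (toLex (i, (j : ℝ)))) (embed v (toLex (i, (j : ℝ) + 1))) =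
      Icc (embed v (toLex (i + a, ((j + P i : ℤ) : ℝ))))
        (embed v (toLex (i + a, ((j + P i : ℤ) : ℝ) + 1))) := by
  rw [OrderIso.image_Icc, hv.action_embed, hv.action_embed]
  push_cast
  rw [add_right_comm]

end IsSubdivision

end Chart

section HolderCriterion

variable {α M : ℝ}

theorem continuous_of_holder {f : ℝ → ℝ} (hα : 0 < α)
    (hf : ∀ x y, |f x - f y| ≤ M * |x - y| ^ α) : Continuous f := by
  refine continuous_iff_continuousAt.2 fun y => tendsto_iff_dist_tendsto_zero.2 ?_
  refine squeeze_zero (fun _ => dist_nonneg) (fun x => hf x y) ?_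
  have hcont : Continuous fun x : ℝ => M * |x - y| ^ α :=
    continuous_const.mul ((continuous_id.sub continuous_const).abs.rpow_const fun _ => Or.inr hα.le)
  simpa [Real.zero_rpow hα.ne'] using hcont.tendsto y

theorem eqOn_add_integral_of_hasDerivAt_off_countable {f D : ℝ → ℝ} {s : Set ℝ}
    (hD : Continuous D) (hf : Continuous f) (hs : s.Countable)
    (hderiv : ∀ x ∈ Ioo (0 : ℝ) 1 \ s, HasDerivAt f (D x) x) :
    EqOn f (fun x => f 0 + ∫ u in (0 : ℝ)..x, D u) (Icc 0 1) := by
  intro x hx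
  have hintegral := MeasureTheory.integral_eq_of_hasDerivAt_off_countable f D (a := 0) (b := x) hs
    hf.continuousOn (fun y hy => hderiv y ⟨?_, hy.2⟩) (hD.intervalIntegrable _ _)
  · simp only [hintegral, add_sub_cancel]
  · have hy' := hy.1
    rw [min_eq_left hx.1, max_eq_right hx.1] at hy'
    exact ⟨hy'.1, hy'.2.trans_le hx.2⟩

theorem isC1Holder_of_hasDerivAt_off_countable {f : I → I} (hα : 0 < α) {D : ℝ → ℝ} {s : Set ℝ}
    (hD : ∀ x y, |D x - D y| ≤ M * |x - y| ^ α) (hf : Continuous (toReal f)) (hs : s.Countable)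
    (hderiv : ∀ x ∈ Ioo (0 : ℝ) 1 \ s, HasDerivAt (toReal f) (D x) x) : IsC1Holder α f := by
  have hDc : Continuous D := continuous_of_holder hα hD
  set G : ℝ → ℝ := fun x => toReal f 0 + ∫ u in (0 : ℝ)..x, D u
  have hG : ∀ x, HasDerivAt G (D x) x := fun x =>
    ((hDc.integral_hasStrictDerivAt 0 x).hasDerivAt).const_add _
  have hfG : EqOn (toReal f) G (Icc 0 1) :=
    eqOn_add_integral_of_hasDerivAt_off_countable hDc hf hs hderiv
  have hderivWithin : ∀ x ∈ Icc (0 : ℝ) 1, derivWithin (toReal f) (Icc 0 1) x = D x := by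
    intro x hx
    rw [derivWithin_congr hfG (hfG hx)]
    exact (hG x).hasDerivWithinAt.derivWithin (uniqueDiffOn_Icc zero_lt_one x hx)
  refine ⟨(contDiff_one_iff_deriv.2 ⟨fun x => (hG x).differentiableAt, ?_⟩).contDiffOn.congr hfG,
    M, fun x hx y hy => by rw [hderivWithin x hx, hderivWithin y hy]; exact hD x y⟩
  rwa [show deriv G = D from funext fun x => (hG x).deriv]

theorem continuous_toReal (F : I ≃o I) : Continuous (toReal F) :=
  continuous_subtype_val.comp (F.continuous.comp continuous_projIcc)

theorem hasDerivAt_of_hasDerivAt_comp {f g : ℝ → ℝ} {t g' d : ℝ} (hg : HasStrictDerivAt g g' t)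
    (hg' : g' ≠ 0) (hfg : HasDerivAt (f ∘ g) d t) : HasDerivAt f (d / g') (g t) := by
  set inv := hg.localInverse g g' t hg'
  have hinv : inv (g t) = t := HasStrictFDerivAt.localInverse_apply_image
    (f' := ContinuousLinearEquiv.unitsEquivAut ℝ (Units.mk0 g' hg')) hg
  have hright : ∀ᶠ y in 𝓝 (g t), g (inv y) = y := HasStrictFDerivAt.eventually_right_inverse
    (f' := ContinuousLinearEquiv.unitsEquivAut ℝ (Units.mk0 g' hg')) hg
  have hcomp := HasDerivAt.comp (h₂ := f ∘ g) (h := inv) (g t) (by rwa [hinv])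
    (hg.to_localInverse hg').hasDerivAt
  refine (hcomp.congr_of_eventuallyEq ?_).congr_deriv (div_eq_mul_inv _ _).symm
  filter_upwards [hright] with y hy
  rw [Function.comp_apply, Function.comp_apply, hy]

end HolderCriterion

section Derivative

variable {v : ℤ ×ₗ ℤ → ℝ} {α M : ℝ} {a : ℤ} {P : ℤ → ℤ}

/-- The derivative of the action of `skew a P`, in the coordinates given by the rows. -/
def rhoRatio (v : ℤ ×ₗ ℤ → ℝ) (a : ℤ) (P : ℤ → ℤ) (i : ℤ) (t : ℝ) : ℝ :=
  rho v (i + a) (t + P i) / rho v i t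

/-- The derivative of the action of `skew a P`; it is `1` at the points outside all rows, which are
the accumulation points of the subdivision. -/
def actionDeriv (v : ℤ ×ₗ ℤ → ℝ) (a : ℤ) (P : ℤ → ℤ) : ℝ → ℝ :=
  Function.extend (fun z : ℤ × ℝ => chart v z.1 z.2) (fun z => rhoRatio v a P z.1 z.2) fun _ => 1

theorem actionDeriv_of_forall_ne {x : ℝ} (hx : ∀ i t, chart v i t ≠ x) :
    actionDeriv v a P x = 1 :=
  Function.extend_apply' _ _ _ fun ⟨z, hz⟩ => hx z.1 z.2 hz

namespace IsSubdivision

variable (hv : IsSubdivision v)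
include hv

theorem chart_injective : Function.Injective fun z : ℤ × ℝ => chart v z.1 z.2 := by
  rintro ⟨i, t⟩ ⟨k, s⟩ (heq : chart v i t = chart v k s)
  rcases lt_trichotomy i k with hik | rfl | hki
  · exact absurd heq (hv.chart_lt_chart hik t s).ne
  · rw [(hv.chart_strictMono i).injective heq]
  · exact absurd heq (hv.chart_lt_chart hki s t).ne'

theorem actionDeriv_chart (i : ℤ) (t : ℝ) :
    actionDeriv v a P (chart v i t) = rhoRatio v a P i t :=
  hv.chart_injective.extend_apply _ _ (i, t)

theorem forall_chart_lt_or_forall_lt_chart {i : ℤ} {x : ℝ} (hx : ∀ t, chart v i t ≠ x) :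
    (∀ t, chart v i t < x) ∨ ∀ t, x < chart v i t := by
  by_contra! hno
  obtain ⟨⟨t, ht⟩, s, hs⟩ := hno
  obtain ⟨r, hr⟩ := mem_range_of_exists_le_of_exists_ge (hv.continuous_chart i) ⟨s, hs⟩ ⟨t, ht⟩
  exact hx r hr

theorem abs_rhoRatio_sub_one_le (hα : 0 ≤ α) (hM : 0 ≤ M) {i : ℤ}
    (hrow : ∀ s t, |rhoRatio v a P i s - rhoRatio v a P i t| ≤
      M * |chart v i s - chart v i t| ^ α)
    (hlim : Tendsto (rhoRatio v a P i) (cocompact ℝ) (𝓝 1)) {x : ℝ} (hx : ∀ t, chart v i t ≠ x)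
    (t : ℝ) : |rhoRatio v a P i t - 1| ≤ M * |chart v i t - x| ^ α := by
  have hmono := (hv.chart_strictMono i).monotone
  obtain ⟨l, hne, hl, hcloser⟩ : ∃ l : Filter ℝ, l.NeBot ∧ l ≤ cocompact ℝ ∧
      ∀ᶠ s in l, |chart v i t - chart v i s| ≤ |chart v i t - x| := by
    rcases hv.forall_chart_lt_or_forall_lt_chart hx with hlt | hgt
    · refine ⟨atTop, inferInstance, atTop_le_cocompact, ?_⟩
      filter_upwards [eventually_ge_atTop t] with s hs
      rw [abs_of_nonpos (sub_nonpos.2 (hmono hs)), abs_of_neg (sub_neg.2 (hlt t))]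
      linarith [hlt s]
    · refine ⟨atBot, inferInstance, atBot_le_cocompact, ?_⟩
      filter_upwards [eventually_le_atBot t] with s hs
      rw [abs_of_nonneg (sub_nonneg.2 (hmono hs)), abs_of_pos (sub_pos.2 (hgt t))]
      linarith [hgt s]
  refine le_of_tendsto (tendsto_const_nhds.sub (hlim.mono_left hl)).abs ?_
  filter_upwards [hcloser] with s hs
  exact (hrow t s).trans
    (mul_le_mul_of_nonneg_left (Real.rpow_le_rpow (abs_nonneg _) hs hα) hM)

theorem abs_actionDeriv_sub_one_le (hα : 0 ≤ α) (hM : 0 ≤ M)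
    (hrow : ∀ i s t, |rhoRatio v a P i s - rhoRatio v a P i t| ≤
      M * |chart v i s - chart v i t| ^ α)
    (hlim : ∀ i, Tendsto (rhoRatio v a P i) (cocompact ℝ) (𝓝 1)) {x y : ℝ}
    (hxy : ∀ i s t, chart v i s = x → chart v i t ≠ y) :
    |actionDeriv v a P x - 1| ≤ M * |x - y| ^ α := by
  by_cases hx : ∃ i s, chart v i s = x
  · obtain ⟨i, s, rfl⟩ := hx
    rw [hv.actionDeriv_chart]
    exact hv.abs_rhoRatio_sub_one_le hα hM (hrow i) (hlim i) (fun t => hxy i s t rfl) s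
  · push Not at hx
    rw [actionDeriv_of_forall_ne hx, sub_self, abs_zero]
    positivity

theorem abs_actionDeriv_sub_le (hα : 0 ≤ α) (hM : 0 ≤ M)
    (hrow : ∀ i s t, |rhoRatio v a P i s - rhoRatio v a P i t| ≤
      M * |chart v i s - chart v i t| ^ α)
    (hlim : ∀ i, Tendsto (rhoRatio v a P i) (cocompact ℝ) (𝓝 1)) (x y : ℝ) :
    |actionDeriv v a P x - actionDeriv v a P y| ≤ 2 * M * |x - y| ^ α := by
  by_cases hsame : ∃ i s t, chart v i s = x ∧ chart v i t = y
  · obtain ⟨i, s, t, rfl, rfl⟩ := hsame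
    rw [hv.actionDeriv_chart, hv.actionDeriv_chart]
    refine (hrow i s t).trans (mul_le_mul_of_nonneg_right ?_ (by positivity))
    linarith
  · push Not at hsame
    have hx := hv.abs_actionDeriv_sub_one_le hα hM hrow hlim hsame
    have hy := hv.abs_actionDeriv_sub_one_le hα hM hrow hlim
      fun i s t hs ht => hsame i t s ht hs
    rw [abs_sub_comm y x, abs_sub_comm] at hy
    linarith [abs_sub_le (actionDeriv v a P x) 1 (actionDeriv v a P y)]

theorem exists_isGreatest_chart_lt {x : ℝ} (hx : x ∈ Ioo (0 : ℝ) 1) :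
    ∃ i : ℤ, IsGreatest {k : ℤ | chart v k 0 < x} i := by
  refine Int.exists_greatest_of_bdd ?_ ?_
  · obtain ⟨b, t, hxt, -⟩ := hv.exists_chart_between hx.1.le hx.2 le_rfl
    exact ⟨b, fun i hi => not_lt.1 fun hbi => (hi.trans hxt).asymm (hv.chart_lt_chart hbi _ _)⟩
  · obtain ⟨i, t, -, hit⟩ := hv.exists_chart_between le_rfl hx.1 hx.2.le
    exact ⟨i - 1, (hv.chart_lt_chart (sub_one_lt i) _ _).trans hit⟩

theorem exists_lt_chart_zero_lt {x y : ℝ} (hx : x ∈ Ioo (0 : ℝ) 1 \ {x | ∃ i t, chart v i t = x})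
    (hy : y ∈ Ioo (0 : ℝ) 1 \ {x | ∃ i t, chart v i t = x}) (hxy : x < y) :
    ∃ k, x < chart v k 0 ∧ chart v k 0 < y := by
  obtain ⟨k, t, hxk, hky⟩ := hv.exists_chart_between hx.1.1.le hxy hy.1.2.le
  refine ⟨k, ?_, ?_⟩
  · exact (hv.forall_chart_lt_or_forall_lt_chart fun s hs => hx.2 ⟨k, s, hs⟩).resolve_left
      (fun h => (h t).asymm hxk) 0
  · exact (hv.forall_chart_lt_or_forall_lt_chart fun s hs => hy.2 ⟨k, s, hs⟩).resolve_right
      (fun h => (h t).asymm hky) 0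

theorem countable_compl_range_chart :
    (Ioo (0 : ℝ) 1 \ {x | ∃ i t, chart v i t = x}).Countable := by
  choose! row hrow using fun x (hx : x ∈ Ioo (0 : ℝ) 1) => hv.exists_isGreatest_chart_lt hx
  refine countable_of_injective_of_countable_image (f := row) ?_ (to_countable _)
  have hlt : ∀ x ∈ Ioo (0 : ℝ) 1 \ {x | ∃ i t, chart v i t = x},
      ∀ y ∈ Ioo (0 : ℝ) 1 \ {x | ∃ i t, chart v i t = x}, x < y → row x < row y := by
    intro x hx y hy hxy
    obtain ⟨k, hxk, hky⟩ := hv.exists_lt_chart_zero_lt hx hy hxy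
    refine lt_of_not_ge fun hle => ?_
    have hrow_le : chart v (row x) 0 < chart v k 0 := (hrow x hx.1).1.trans hxk
    exact hrow_le.not_ge (((hrow y hy.1).2 hky).trans hle |>.eq_or_lt.elim (fun h => h ▸ le_rfl)
      fun h => (hv.chart_lt_chart h 0 0).le)
  exact StrictMonoOn.injOn fun x hx y hy hxy => hlt x hx y hy hxy

end IsSubdivision

namespace IsSubdivision

variable (hv : IsSubdivision v)

theorem toReal_action_chart (i : ℤ) (t : ℝ) :
    toReal (hv.action (skew a P)) (chart v i t) = chart v (i + a) (t + P i) := by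
  rw [← hv.coe_embed, toReal, projIcc_val, hv.action_embed, hv.coe_embed]

theorem hasDerivAt_toReal_action (i : ℤ) (t : ℝ) :
    HasDerivAt (toReal (hv.action (skew a P))) (rhoRatio v a P i t) (chart v i t) := by
  refine hasDerivAt_of_hasDerivAt_comp (hasStrictDerivAt_of_hasDerivAt_of_continuousAt
    (Eventually.of_forall (hv.hasDerivAt_chart i)) (continuous_rho v i).continuousAt)
    (hv.rho_pos i t).ne' ?_
  rw [show toReal (hv.action (skew a P)) ∘ chart v i = fun s => chart v (i + a) (s + P i) from
    funext (hv.toReal_action_chart i)]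
  exact (hv.hasDerivAt_chart (i + a) (t + P i)).comp_add_const t _

theorem isC1Holder_action (hα : 0 < α) (hM : 0 ≤ M)
    (hrow : ∀ i s t, |rhoRatio v a P i s - rhoRatio v a P i t| ≤
      M * |chart v i s - chart v i t| ^ α)
    (hlim : ∀ i, Tendsto (rhoRatio v a P i) (cocompact ℝ) (𝓝 1)) :
    IsC1Holder α (hv.action (skew a P)) := by
  refine isC1Holder_of_hasDerivAt_off_countable hα (hv.abs_actionDeriv_sub_le hα.le hM hrow hlim)
    (continuous_toReal _) hv.countable_compl_range_chart fun x hx => ?_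
  obtain ⟨i, t, rfl⟩ : ∃ i t, chart v i t = x := by
    by_contra hno
    exact hx.2 ⟨hx.1, hno⟩
  rw [hv.actionDeriv_chart]
  exact hv.hasDerivAt_toReal_action i t

end IsSubdivision

end Derivative

section Asymptotics

variable {X : Type*} {l : Filter X} {f g h : X → ℝ} {α : ℝ}

theorem isBigO_rpow_of_le (hf : ∀ x, 1 ≤ f x) {a b : ℝ} (hab : a ≤ b) :
    (fun x => f x ^ a) =O[l] fun x => f x ^ b :=
  .of_norm_le fun x => by
    rw [Real.norm_of_nonneg (Real.rpow_nonneg (zero_le_one.trans (hf x)) _)]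
    exact Real.rpow_le_rpow_of_exponent_le (hf x) hab

theorem isBigO_interpolate (hα₀ : 0 ≤ α) (hα₁ : α ≤ 1) (hg : f =O[l] g) (hh : f =O[l] h) :
    f =O[l] fun x => |g x| ^ (1 - α) * |h x| ^ α := by
  have hfα : ∀ x, |f x| = |f x| ^ (1 - α) * |f x| ^ α := fun x => by
    rw [← Real.rpow_add' (abs_nonneg _) (by simp), sub_add_cancel, Real.rpow_one]
  rw [← isBigO_abs_left, funext hfα]
  exact (hg.abs_abs.rpow (sub_nonneg.2 hα₁) (.of_forall fun _ => abs_nonneg _)).mul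
    (hh.abs_abs.rpow hα₀ (.of_forall fun _ => abs_nonneg _))

theorem isTheta_of_abs_sub_le_half (hg : ∀ x, 0 ≤ g x) (hfg : ∀ᶠ x in l, |f x - g x| ≤ g x / 2) :
    f =Θ[l] g := by
  have hbounds : ∀ᶠ x in l, g x / 2 ≤ f x ∧ f x ≤ 3 / 2 * g x := hfg.mono fun x hx =>
    ⟨by linarith [(abs_le.1 hx).1], by linarith [(abs_le.1 hx).2]⟩
  refine ⟨.of_bound (3 / 2) (hbounds.mono fun x hx => ?_),
    .of_bound 2 (hbounds.mono fun x hx => ?_)⟩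
  all_goals
    have hf₀ : 0 ≤ f x := (div_nonneg (hg x) zero_le_two).trans hx.1
    rw [Real.norm_of_nonneg (hg x), Real.norm_of_nonneg hf₀]
    linarith

theorem exists_mem_uIcc_sub_eq {f f' : ℝ → ℝ} (hf : ∀ x, HasDerivAt f (f' x) x) (s t : ℝ) :
    ∃ r ∈ uIcc s t, f s - f t = f' r * (s - t) := by
  wlog hts : t ≤ s generalizing s t
  · obtain ⟨r, hr, heq⟩ := this t s (le_of_not_ge hts)
    exact ⟨r, uIcc_comm t s ▸ hr, by linarith⟩
  rcases hts.eq_or_lt with rfl | hlt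
  · exact ⟨t, left_mem_uIcc, by simp⟩
  obtain ⟨r, hr, heq⟩ := exists_hasDerivAt_eq_slope f f' hlt
    (fun x _ => (hf x).continuousAt.continuousWithinAt) fun x _ => hf x
  refine ⟨r, uIcc_of_ge hts ▸ Ioo_subset_Icc_self hr, ?_⟩
  rw [heq, div_mul_cancel₀ _ (sub_pos.2 hlt).ne']

end Asymptotics

section RowEstimate

variable {ι X : Type*} {l : Filter X} {T : ι → ℝ}

/-- The size of a point of `ι × ℝ`, in terms of which all decay rates are expressed. -/
def scale (T : ι → ℝ) (z : ι × ℝ) : ℝ := T z.1 + |z.2|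

theorem one_le_scale (hT : ∀ i, 1 ≤ T i) (z : ι × ℝ) : 1 ≤ scale T z :=
  (hT z.1).trans (le_add_of_nonneg_right (abs_nonneg _))

theorem scale_pos (hT : ∀ i, 1 ≤ T i) (z : ι × ℝ) : 0 < scale T z :=
  zero_lt_one.trans_le (one_le_scale hT z)

theorem isBigO_fst_scale (hT : ∀ i, 1 ≤ T i) (i : X → ι) (t : X → ℝ) :
    (fun x => T (i x)) =O[l] fun x => scale T (i x, t x) := .of_norm_le fun x => by
  rw [Real.norm_of_nonneg (zero_le_one.trans (hT (i x)))]
  exact le_add_of_nonneg_right (abs_nonneg _)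

theorem isBigO_snd_scale (hT : ∀ i, 1 ≤ T i) (i : X → ι) (t : X → ℝ) :
    t =O[l] fun x => scale T (i x, t x) := .of_norm_le fun x =>
  le_add_of_nonneg_left (zero_le_one.trans (hT (i x)))

theorem abs_scale_sub_le (T : ι → ℝ) (i : ι) (s t : ℝ) :
    |scale T (i, s) - scale T (i, t)| ≤ |s - t| := by
  rw [scale, scale, add_sub_add_left_eq_sub]
  exact abs_abs_sub_abs_le_abs_sub s t

theorem isTheta_scale_rpow_of_abs_sub_le_half (hT : ∀ i, 1 ≤ T i) {i : X → ι} {s t : X → ℝ}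
    (hst : ∀ᶠ x in l, |s x - t x| ≤ scale T (i x, t x) / 2) (a : ℝ) :
    (fun x => scale T (i x, s x) ^ a) =Θ[l] fun x => scale T (i x, t x) ^ a :=
  (isTheta_of_abs_sub_le_half (fun _ => (scale_pos hT _).le)
    (hst.mono fun _ hx => (abs_scale_sub_le T _ _ _).trans hx)).rpow
    (.of_forall fun _ => (scale_pos hT _).le) (.of_forall fun _ => (scale_pos hT _).le)

variable {u u' c ρ : ι → ℝ → ℝ} {α q a b : ℝ} {i : X → ι} {s t : X → ℝ}

theorem exists_sub_eq_and_abs_sub_le (hu : ∀ i t, HasDerivAt (u i) (u' i t) t) (i : X → ι)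
    (s t : X → ℝ) : ∃ r : X → ℝ, (∀ x, |r x - t x| ≤ |s x - t x|) ∧
      ∀ x, u (i x) (s x) - u (i x) (t x) = u' (i x) (r x) * (s x - t x) := by
  choose r hr heq using fun x => exists_mem_uIcc_sub_eq (hu (i x)) (s x) (t x)
  refine ⟨r, fun x => ?_, heq⟩
  rw [abs_sub_comm, abs_sub_comm (s x)]
  exact abs_sub_right_of_mem_uIcc (hr x)

theorem isBigO_sub_of_near (hT : ∀ i, 1 ≤ T i) (hu : ∀ i t, HasDerivAt (u i) (u' i t) t)
    (hu' : (fun z : ι × ℝ => u' z.1 z.2) =O[⊤] fun z => scale T z ^ (-b))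
    (hst : ∀ᶠ x in l, |s x - t x| ≤ scale T (i x, t x) / 2) :
    (fun x => u (i x) (s x) - u (i x) (t x)) =O[l]
      fun x => scale T (i x, t x) ^ (-b) * (s x - t x) := by
  obtain ⟨r, hr, heq⟩ := exists_sub_eq_and_abs_sub_le hu i s t
  simp_rw [heq]
  have hrt := isTheta_scale_rpow_of_abs_sub_le_half hT
    (hst.mono fun x hx => (hr x).trans hx) (-b)
  exact ((hu'.comp_tendsto (tendsto_top (f := fun x => (i x, r x)))).trans hrt.1).mul
    (isBigO_refl _ _)

theorem isBigO_sub_chart_of_near (hT : ∀ i, 1 ≤ T i) (hc : ∀ i t, HasDerivAt (c i) (ρ i t) t)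
    (hρ : (fun z => scale T z ^ (-q)) =O[⊤] fun z : ι × ℝ => ρ z.1 z.2)
    (hst : ∀ᶠ x in l, |s x - t x| ≤ scale T (i x, t x) / 2) :
    (fun x => scale T (i x, t x) ^ (-q) * (s x - t x)) =O[l]
      fun x => c (i x) (s x) - c (i x) (t x) := by
  obtain ⟨r, hr, heq⟩ := exists_sub_eq_and_abs_sub_le hc i s t
  simp_rw [heq]
  have hrt := isTheta_scale_rpow_of_abs_sub_le_half hT
    (hst.mono fun x hx => (hr x).trans hx) (-q)
  exact (hrt.2.trans (hρ.comp_tendsto (tendsto_top (f := fun x => (i x, r x))))).mul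
    (isBigO_refl _ _)

theorem isBigO_sub_rpow_of_near (hT : ∀ i, 1 ≤ T i) (hα₀ : 0 ≤ α) (hα₁ : α ≤ 1)
    (hab : q * α ≤ a * (1 - α) + b * α)
    (hu : (fun z : ι × ℝ => u z.1 z.2) =O[⊤] fun z => scale T z ^ (-a))
    (hd : ∀ i t, HasDerivAt (u i) (u' i t) t)
    (hu' : (fun z : ι × ℝ => u' z.1 z.2) =O[⊤] fun z => scale T z ^ (-b))
    (hc : ∀ i t, HasDerivAt (c i) (ρ i t) t)
    (hρ : (fun z => scale T z ^ (-q)) =O[⊤] fun z : ι × ℝ => ρ z.1 z.2)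
    (hst : ∀ᶠ x in l, |s x - t x| ≤ scale T (i x, t x) / 2) :
    (fun x => u (i x) (s x) - u (i x) (t x)) =O[l]
      fun x => |c (i x) (s x) - c (i x) (t x)| ^ α := by
  have hsize : (fun x => u (i x) (s x) - u (i x) (t x)) =O[l]
      fun x => scale T (i x, t x) ^ (-a) :=
    ((hu.comp_tendsto (tendsto_top (f := fun x => (i x, s x)))).trans
      (isTheta_scale_rpow_of_abs_sub_le_half hT hst _).1).sub
      (hu.comp_tendsto (tendsto_top (f := fun x => (i x, t x))))
  refine (isBigO_interpolate hα₀ hα₁ hsize (isBigO_sub_of_near hT hd hu' hst)).trans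
    (IsBigO.trans ?_ ((isBigO_sub_chart_of_near hT hc hρ hst).abs_abs.rpow hα₀
      (.of_forall fun _ => abs_nonneg _)))
  have hexp := isBigO_rpow_of_le (l := l) (fun x => one_le_scale hT (i x, t x))
    (a := -a * (1 - α) + -b * α) (b := -q * α) (by linarith)
  refine (hexp.mul (isBigO_refl (fun x => |s x - t x| ^ α) l)).congr (fun x => ?_) fun x => ?_
  all_goals have hpos := scale_pos hT (i x, t x)
  · rw [abs_mul, Real.mul_rpow (abs_nonneg _) (abs_nonneg _), Real.abs_rpow_of_nonneg hpos.le,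
      Real.abs_rpow_of_nonneg hpos.le, abs_of_pos hpos, ← Real.rpow_mul hpos.le,
      ← Real.rpow_mul hpos.le, ← mul_assoc, ← Real.rpow_add hpos]
  · rw [abs_mul, Real.mul_rpow (abs_nonneg _) (abs_nonneg _), Real.abs_rpow_of_nonneg hpos.le,
      abs_of_pos hpos, ← Real.rpow_mul hpos.le]

theorem exists_mem_uIcc_abs_sub_eq {s t d : ℝ} (hd : 0 ≤ d) (hst : d ≤ |s - t|) :
    ∃ r ∈ uIcc s t, |r - t| = d := by
  rcases le_total s t with hle | hle
  · rw [abs_of_nonpos (sub_nonpos.2 hle)] at hst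
    exact ⟨t - d, mem_uIcc_of_le (by linarith) (by linarith), by
      rw [sub_sub_cancel_left, abs_neg, abs_of_nonneg hd]⟩
  · rw [abs_of_nonneg (sub_nonneg.2 hle)] at hst
    exact ⟨t + d, mem_uIcc_of_ge (by linarith) (by linarith), by
      rw [add_sub_cancel_left, abs_of_nonneg hd]⟩

theorem isBigO_sub_chart_of_far (hT : ∀ i, 1 ≤ T i) (hc : ∀ i t, HasDerivAt (c i) (ρ i t) t)
    (hmono : ∀ i, Monotone (c i))
    (hρ : (fun z => scale T z ^ (-q)) =O[⊤] fun z : ι × ℝ => ρ z.1 z.2)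
    (hst : (fun x => scale T (i x, t x)) =O[l] fun x => s x - t x) :
    (fun x => scale T (i x, t x) ^ (1 - q)) =O[l] fun x => c (i x) (s x) - c (i x) (t x) := by
  obtain ⟨C, hC, hbound⟩ := hst.exists_pos
  have hpos := fun x => scale_pos hT (i x, t x)
  have hfar : ∀ᶠ x in l, scale T (i x, t x) / (2 + C) ≤ |s x - t x| := hbound.bound.mono
    fun x hx => by
      rw [Real.norm_of_nonneg (hpos x).le, Real.norm_eq_abs] at hx
      rw [div_le_iff₀' (by positivity)]
      linarith [abs_nonneg (s x - t x)]
  choose! r hr hrt using fun x (hx : scale T (i x, t x) / (2 + C) ≤ |s x - t x|) =>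
    exists_mem_uIcc_abs_sub_eq (div_nonneg (hpos x).le (by positivity)) hx
  have hnear : ∀ᶠ x in l, |r x - t x| ≤ scale T (i x, t x) / 2 := hfar.mono fun x hx =>
    (hrt x hx).trans_le (div_le_div_of_nonneg_left (hpos x).le two_pos (by linarith))
  have hrt' : (fun x => scale T (i x, t x)) =O[l] fun x => r x - t x :=
    .of_bound (2 + C) (hfar.mono fun x hx => by
      rw [Real.norm_of_nonneg (hpos x).le, Real.norm_eq_abs, hrt x hx,
        mul_div_cancel₀ _ (by positivity)])
  have hcr : (fun x => c (i x) (r x) - c (i x) (t x)) =O[l]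
      fun x => c (i x) (s x) - c (i x) (t x) := .of_bound' (hfar.mono fun x hx => by
    rw [Real.norm_eq_abs, Real.norm_eq_abs, abs_sub_comm, abs_sub_comm (c (i x) (s x))]
    exact abs_sub_right_of_mem_uIcc ((hmono (i x)).mapsTo_uIcc (hr x hx)))
  refine (((isBigO_refl _ l).mul hrt').trans
    ((isBigO_sub_chart_of_near hT hc hρ hnear).trans hcr)).congr_left fun x => ?_
  rw [sub_eq_neg_add, Real.rpow_add_one (hpos x).ne']

theorem isBigO_rpow_of_far (hT : ∀ i, 1 ≤ T i) (hα : 0 ≤ α) (ha : α * (q - 1) ≤ a)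
    (hu : (fun z : ι × ℝ => u z.1 z.2) =O[⊤] fun z => scale T z ^ (-a))
    (hc : ∀ i t, HasDerivAt (c i) (ρ i t) t) (hmono : ∀ i, Monotone (c i))
    (hρ : (fun z => scale T z ^ (-q)) =O[⊤] fun z : ι × ℝ => ρ z.1 z.2)
    (hst : (fun x => scale T (i x, t x)) =O[l] fun x => s x - t x) :
    (fun x => u (i x) (t x)) =O[l] fun x => |c (i x) (s x) - c (i x) (t x)| ^ α := by
  have hchart := (isBigO_sub_chart_of_far hT hc hmono hρ hst).abs_right.rpow hα
    (.of_forall fun _ => abs_nonneg _)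
  simp only [← Real.rpow_mul (scale_pos hT _).le] at hchart
  exact ((hu.comp_tendsto (tendsto_top (f := fun x => (i x, t x)))).trans
    (isBigO_rpow_of_le (fun x => one_le_scale hT (i x, t x)) (by linarith))).trans hchart

theorem exists_abs_sub_le_mul_rpow (hT : ∀ i, 1 ≤ T i) (hα₀ : 0 ≤ α) (hα₁ : α ≤ 1)
    (ha : α * (q - 1) ≤ a) (hab : q * α ≤ a * (1 - α) + b * α)
    (hu : (fun z : ι × ℝ => u z.1 z.2) =O[⊤] fun z => scale T z ^ (-a))
    (hd : ∀ i t, HasDerivAt (u i) (u' i t) t)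
    (hu' : (fun z : ι × ℝ => u' z.1 z.2) =O[⊤] fun z => scale T z ^ (-b))
    (hc : ∀ i t, HasDerivAt (c i) (ρ i t) t) (hmono : ∀ i, Monotone (c i))
    (hρ : (fun z => scale T z ^ (-q)) =O[⊤] fun z : ι × ℝ => ρ z.1 z.2) :
    ∃ M, 0 ≤ M ∧ ∀ i s t, |u i s - u i t| ≤ M * |c i s - c i t| ^ α := by
  -- Two points of a row are close with respect to their sizes, or their distance bounds both sizes.
  set near : Set (ι × ℝ × ℝ) := {x | |x.2.1 - x.2.2| ≤ scale T (x.1, x.2.2) / 2}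
  have hfar : ∀ᶠ x in 𝓟 nearᶜ, scale T (x.1, x.2.2) ≤ 2 * |x.2.1 - x.2.2| := fun x hx => by
    have hx' : scale T (x.1, x.2.2) / 2 < |x.2.1 - x.2.2| := not_le.1 hx
    rw [mem_ofPred_eq]
    linarith
  have hts : (fun x => scale T (x.1, x.2.2)) =O[𝓟 nearᶜ] fun x => x.2.1 - x.2.2 :=
    .of_bound 2 (hfar.mono fun x hx => by rwa [Real.norm_of_nonneg (scale_pos hT _).le])
  have hst : (fun x => scale T (x.1, x.2.1)) =O[𝓟 nearᶜ] fun x => x.2.2 - x.2.1 :=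
    .of_bound 3 (hfar.mono fun x hx => by
      rw [Real.norm_of_nonneg (scale_pos hT _).le, Real.norm_eq_abs, abs_sub_comm]
      linarith [(abs_le.1 (abs_scale_sub_le T x.1 x.2.1 x.2.2)).2])
  have hfar_s := isBigO_rpow_of_far hT hα₀ ha hu hc hmono hρ hst
  simp_rw [fun x : ι × ℝ × ℝ => abs_sub_comm (c x.1 x.2.2) (c x.1 x.2.1)] at hfar_s
  have hnear := isBigO_sub_rpow_of_near hT hα₀ hα₁ hab hu hd hu' hc hρ
    (eventually_mem_principal near)
  have hsup := hnear.sup (hfar_s.sub (isBigO_rpow_of_far hT hα₀ ha hu hc hmono hρ hts))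
  rw [sup_principal, union_compl_self, principal_univ] at hsup
  obtain ⟨M, hM, hbound⟩ := hsup.exists_nonneg
  refine ⟨M, hM, fun i s t => ?_⟩
  simpa only [Real.norm_eq_abs, Real.abs_rpow_of_nonneg (abs_nonneg _), abs_abs] using
    isBigOWith_top.1 hbound (i, s, t)

end RowEstimate

section Powers

variable {X : Type*} {l : Filter X} {f g τ : X → ℝ} {q : ℝ}

theorem add_rpow_le_mul_rpow_add_rpow {x y : ℝ} (hq : 1 ≤ q) (hx : 0 ≤ x) (hy : 0 ≤ y) :
    (x + y) ^ q ≤ 2 ^ (q - 1) * (x ^ q + y ^ q) := by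
  exact_mod_cast NNReal.rpow_add_le_mul_rpow_add_rpow ⟨x, hx⟩ ⟨y, hy⟩ hq

theorem isTheta_rpow_add_rpow (hq : 1 ≤ q) (hf : ∀ x, 0 ≤ f x) (hg : ∀ x, 0 ≤ g x) :
    (fun x => f x ^ q + g x ^ q) =Θ[l] fun x => (f x + g x) ^ q := by
  have hsum : ∀ x, 0 ≤ f x ^ q + g x ^ q := fun x =>
    add_nonneg (Real.rpow_nonneg (hf x) q) (Real.rpow_nonneg (hg x) q)
  have hpow : ∀ x, 0 ≤ (f x + g x) ^ q := fun x => Real.rpow_nonneg (add_nonneg (hf x) (hg x)) q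
  refine ⟨.of_norm_le fun x => ?_, .of_bound (2 ^ (q - 1)) (.of_forall fun x => ?_)⟩
  · rw [Real.norm_of_nonneg (hsum x)]
    exact_mod_cast NNReal.add_rpow_le_rpow_add ⟨f x, hf x⟩ ⟨g x, hg x⟩ hq
  · rw [Real.norm_of_nonneg (hpow x), Real.norm_of_nonneg (hsum x)]
    exact add_rpow_le_mul_rpow_add_rpow hq (hf x) (hg x)

theorem isTheta_add_of_nonneg {f₁ f₂ g₁ g₂ : X → ℝ} (hf₁ : ∀ x, 0 ≤ f₁ x) (hf₂ : ∀ x, 0 ≤ f₂ x)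
    (hg₁ : ∀ x, 0 ≤ g₁ x) (hg₂ : ∀ x, 0 ≤ g₂ x) (h₁ : f₁ =Θ[l] g₁) (h₂ : f₂ =Θ[l] g₂) :
    (fun x => f₁ x + f₂ x) =Θ[l] fun x => g₁ x + g₂ x := by
  have hO := h₁.1.add_add h₂.1
  have hΩ := h₁.2.add_add h₂.2
  simp only [Real.norm_of_nonneg (hg₁ _), Real.norm_of_nonneg (hg₂ _)] at hO
  simp only [Real.norm_of_nonneg (hf₁ _), Real.norm_of_nonneg (hf₂ _)] at hΩ
  exact ⟨hO, hΩ⟩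

theorem isBigO_rpow_sub_rpow (hq : 1 ≤ q) (hg : ∀ x, 0 ≤ g x)
    (hfg : (fun x => f x - g x) =O[l] fun _ => (1 : ℝ)) :
    (fun x => f x ^ q - g x ^ q) =O[l] fun x => (1 + g x) ^ (q - 1) := by
  choose m hm heq using fun x =>
    exists_mem_uIcc_sub_eq (fun y => Real.hasDerivAt_rpow_const (.inr hq)) (f x) (g x)
  have hg₁ : ∀ x, 0 ≤ 1 + g x := fun x => add_nonneg zero_le_one (hg x)
  have hone : (fun _ => (1 : ℝ)) =O[l] fun x => 1 + g x := .of_norm_le fun x => by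
    rw [norm_one]
    exact le_add_of_nonneg_right (hg x)
  have hg_le : g =O[l] fun x => 1 + g x := .of_norm_le fun x => by
    rw [Real.norm_of_nonneg (hg x)]
    exact le_add_of_nonneg_left zero_le_one
  have hmg : (fun x => m x - g x) =O[l] fun x => f x - g x := .of_bound' (.of_forall fun x => by
    rw [Real.norm_eq_abs, Real.norm_eq_abs, abs_sub_comm, abs_sub_comm (f x)]
    exact abs_sub_right_of_mem_uIcc (hm x))
  have hmO : m =O[l] fun x => 1 + g x := by
    simpa only [sub_add_cancel] using ((hmg.trans hfg).trans hone).add hg_le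
  have hpow := (hmO.rpow (sub_nonneg.2 hq) (.of_forall hg₁)).const_mul_left q
  simpa only [heq, mul_one] using hpow.mul hfg

theorem isBigO_mul_rpow (hτ : ∀ x, 0 < τ x) {a b : ℝ} (hf : f =O[l] fun x => τ x ^ a)
    (hg : g =O[l] fun x => τ x ^ b) : (fun x => f x * g x) =O[l] fun x => τ x ^ (a + b) := by
  simpa only [Real.rpow_add (hτ _)] using hf.mul hg

theorem isTheta_inv_rpow (hτ : ∀ x, 0 < τ x) {a : ℝ} (hf : f =Θ[l] fun x => τ x ^ a) :
    (fun x => (f x)⁻¹) =Θ[l] fun x => τ x ^ (-a) := by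
  simpa only [Real.rpow_neg (hτ _).le] using hf.inv

variable {w₁ w₂ w₁₁ w₁₂ w₂₁ w₂₂ : X → ℝ} {a b : ℝ}

theorem isBigO_inv_sub_inv (hτ : ∀ x, 0 < τ x) (hw₁ : w₁ =Θ[l] fun x => τ x ^ q)
    (hw₂ : w₂ =Θ[l] fun x => τ x ^ q) (hne₁ : ∀ x, w₁ x ≠ 0) (hne₂ : ∀ x, w₂ x ≠ 0)
    (hdiff : (fun x => w₁ x - w₂ x) =O[l] fun x => τ x ^ (q - a)) :
    (fun x => (w₁ x)⁻¹ - (w₂ x)⁻¹) =O[l] fun x => τ x ^ (-q - a) := by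
  have hprod := isBigO_mul_rpow hτ (isBigO_mul_rpow hτ hdiff.neg_left (isTheta_inv_rpow hτ hw₁).1)
    (isTheta_inv_rpow hτ hw₂).1
  refine hprod.congr (fun x => ?_) fun x => by ring_nf
  rw [neg_sub, inv_sub_inv (hne₁ x) (hne₂ x), div_eq_mul_inv, mul_inv, mul_assoc]

theorem isBigO_mixed_inv_sub_inv (hτ : ∀ x, 0 < τ x) (hw₁₁ : w₁₁ =Θ[l] fun x => τ x ^ q)
    (hw₁₂ : w₁₂ =Θ[l] fun x => τ x ^ q) (hw₂₁ : w₂₁ =Θ[l] fun x => τ x ^ q)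
    (hw₂₂ : w₂₂ =Θ[l] fun x => τ x ^ q) (hne₁₁ : ∀ x, w₁₁ x ≠ 0) (hne₁₂ : ∀ x, w₁₂ x ≠ 0)
    (hne₂₁ : ∀ x, w₂₁ x ≠ 0) (hne₂₂ : ∀ x, w₂₂ x ≠ 0)
    (hmixed : ∀ x, w₂₂ x - w₁₂ x = w₂₁ x - w₁₁ x)
    (hrow : (fun x => w₁₂ x - w₁₁ x) =O[l] fun x => τ x ^ (q - b))
    (hcol : (fun x => w₂₁ x - w₁₁ x) =O[l] fun x => τ x ^ (q - a)) :
    (fun x => ((w₂₂ x)⁻¹ - (w₁₂ x)⁻¹) - ((w₂₁ x)⁻¹ - (w₁₁ x)⁻¹)) =O[l]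
      fun x => τ x ^ (-q - a - b) := by
  have hinv₁ := isBigO_mul_rpow hτ (isTheta_inv_rpow hτ hw₁₁).1 (isTheta_inv_rpow hτ hw₁₂).1
  have hinv₂ := isBigO_mul_rpow hτ (isTheta_inv_rpow hτ hw₂₁).1 (isTheta_inv_rpow hτ hw₂₂).1
  have hnum := isBigO_mul_rpow hτ (isBigO_mul_rpow hτ hcol hrow) (hw₁₁.1.add hw₂₂.1)
  refine (isBigO_mul_rpow hτ hnum (isBigO_mul_rpow hτ hinv₁ hinv₂)).congr (fun x => ?_)
    fun x => by ring_nf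
  have h₁₁ := hne₁₁ x
  have h₁₂ := hne₁₂ x
  have h₂₁ := hne₂₁ x
  have h₂₂ := hne₂₂ x
  have hw : w₂₂ x = w₁₂ x + w₂₁ x - w₁₁ x := by linear_combination hmixed x
  field_simp
  rw [hw]
  ring

end Powers

section Lengths

/-- The reciprocal of `blockLength p q (i, j)`. -/
def invLength (p q : ℝ) (i j : ℤ) : ℝ := |(i : ℝ)| ^ p + |(j : ℝ)| ^ q + 1

theorem blockLength_toLex (p q : ℝ) (i j : ℤ) :
    blockLength p q (toLex (i, j)) = (invLength p q i j)⁻¹ := one_div _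

theorem invLength_pos (p q : ℝ) (i j : ℤ) : 0 < invLength p q i j := by
  unfold invLength
  positivity

theorem blockLength_pos (p q : ℝ) (n : ℤ ×ₗ ℤ) : 0 < blockLength p q n :=
  one_div_pos.2 (invLength_pos p q _ _)

/-- The index at which the lengths `blockLength (κ * q) q (i, j)` of the `i`-th row start to
decay. -/
def rowSize (κ : ℝ) (i : ℤ) : ℝ := (1 + |(i : ℝ)|) ^ κ

variable {X : Type*} {l : Filter X} {κ q : ℝ}

theorem one_le_rowSize (hκ : 0 ≤ κ) (i : ℤ) : 1 ≤ rowSize κ i :=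
  Real.one_le_rpow (le_add_of_nonneg_right (abs_nonneg _)) hκ

theorem rowSize_rpow (κ a : ℝ) (i : ℤ) : rowSize κ i ^ a = (1 + |(i : ℝ)|) ^ (κ * a) :=
  (Real.rpow_mul (by positivity) κ a).symm

theorem isBigO_one_rowSize (hκ : 0 ≤ κ) (i : X → ℤ) :
    (fun _ => (1 : ℝ)) =O[l] fun x => rowSize κ (i x) := .of_norm_le fun x => by
  rw [norm_one]
  exact one_le_rowSize hκ (i x)

theorem isBigO_rowSize_of_sub_isBigO_one (hκ : 0 ≤ κ) {i i' : X → ℤ}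
    (hi : (fun x => (i' x : ℝ) - i x) =O[l] fun _ => (1 : ℝ)) :
    (fun x => rowSize κ (i' x)) =O[l] fun x => rowSize κ (i x) := by
  have hone : (fun _ => (1 : ℝ)) =O[l] fun x => 1 + |(i x : ℝ)| := by
    simpa only [rowSize, Real.rpow_one] using isBigO_one_rowSize zero_le_one i
  have hself : (fun x => (i x : ℝ)) =O[l] fun x => 1 + |(i x : ℝ)| := .of_norm_le fun x =>
    le_add_of_nonneg_left zero_le_one
  have habs : (fun x => |(i' x : ℝ)|) =O[l] fun x => 1 + |(i x : ℝ)| := by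
    simpa only [sub_add_cancel] using ((hi.trans hone).add hself).abs_left
  exact (hone.add habs).rpow hκ (.of_forall fun x => by positivity)

theorem isTheta_scale_rowSize (hκ : 0 ≤ κ) {i i' : X → ℤ} {s t : X → ℝ}
    (hi : (fun x => (i' x : ℝ) - i x) =O[l] fun _ => (1 : ℝ))
    (hst : (fun x => s x - t x) =O[l] fun x => rowSize κ (i x)) :
    (fun x => scale (rowSize κ) (i' x, s x)) =Θ[l] fun x => scale (rowSize κ) (i x, t x) := by
  have hle {i i' : X → ℤ} {s t : X → ℝ}
      (hi : (fun x => (i' x : ℝ) - i x) =O[l] fun _ => (1 : ℝ))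
      (hst : (fun x => s x - t x) =O[l] fun x => rowSize κ (i x)) :
      (fun x => scale (rowSize κ) (i' x, s x)) =O[l] fun x => scale (rowSize κ) (i x, t x) := by
    have hrow := isBigO_fst_scale (l := l) (one_le_rowSize hκ) i t
    have hs := (hst.trans hrow).add (isBigO_snd_scale (one_le_rowSize hκ) i t)
    simp only [sub_add_cancel] at hs
    exact ((isBigO_rowSize_of_sub_isBigO_one hκ hi).trans hrow).add hs.abs_left
  have hi' : (fun x => (i x : ℝ) - i' x) =O[l] fun _ => (1 : ℝ) := by
    simpa only [neg_sub] using hi.neg_left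
  refine ⟨hle hi hst, hle hi' ?_⟩
  simpa only [neg_sub] using (hst.trans (isBigO_rowSize_of_sub_isBigO_one hκ hi')).neg_left

theorem isBigO_intCast_add_sub_one (i : X → ℤ) (a : ℤ) :
    (fun x => ((i x + a : ℤ) : ℝ) - i x) =O[l] fun _ => (1 : ℝ) := by
  simpa only [Int.cast_add, add_sub_cancel_left] using isBigO_const_const (a : ℝ) one_ne_zero l

theorem isBigO_floor_add_sub_one (t : X → ℝ) (e : ℤ) :
    (fun x => ((⌊t x⌋ + e : ℤ) : ℝ) - t x) =O[l] fun _ => (1 : ℝ) := by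
  have hfract := ((isBigO_comp_fract (l := l) continuous_id t).neg_left).add
    (isBigO_const_const (e : ℝ) one_ne_zero l)
  refine hfract.congr_left fun x => ?_
  rw [id, Int.fract]
  push_cast
  ring

theorem isTheta_scale_floor (hκ : 0 ≤ κ) (a e : ℤ) :
    (fun z : ℤ × ℝ => scale (rowSize κ) (z.1 + a, ((⌊z.2⌋ + e : ℤ) : ℝ))) =Θ[⊤]
      scale (rowSize κ) :=
  isTheta_scale_rowSize hκ (isBigO_intCast_add_sub_one _ a)
    ((isBigO_floor_add_sub_one _ e).trans (isBigO_one_rowSize hκ _))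

theorem isTheta_invLength (hκ : 1 ≤ κ) (hq : 1 ≤ q) (i j : X → ℤ) :
    (fun x => invLength (κ * q) q (i x) (j x)) =Θ[l]
      fun x => scale (rowSize κ) (i x, (j x : ℝ)) ^ q := by
  have hrow : (fun x => 1 + |(i x : ℝ)| ^ (κ * q)) =Θ[l] fun x => rowSize κ (i x) ^ q := by
    simpa only [rowSize_rpow, Real.one_rpow] using
      isTheta_rpow_add_rpow (one_le_mul_of_one_le_of_one_le hκ hq)
        (fun _ => zero_le_one) fun x => abs_nonneg (i x : ℝ)
  have hrowSize : ∀ i, 0 ≤ rowSize κ i := fun i => by unfold rowSize; positivity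
  have hsum := isTheta_add_of_nonneg (fun x => by positivity)
    (fun x => Real.rpow_nonneg (abs_nonneg (j x : ℝ)) q)
    (fun x => Real.rpow_nonneg (hrowSize (i x)) q)
    (fun x => Real.rpow_nonneg (abs_nonneg (j x : ℝ)) q) hrow (isTheta_refl _ l)
  have hinv : ∀ i j : ℤ, invLength (κ * q) q i j = 1 + |(i : ℝ)| ^ (κ * q) + |(j : ℝ)| ^ q :=
    fun i j => by rw [invLength]; ring
  simp only [hinv]
  exact hsum.trans (isTheta_rpow_add_rpow hq (fun x => hrowSize (i x)) fun x => abs_nonneg _)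

theorem isTheta_invLength_floor (hκ : 1 ≤ κ) (hq : 1 ≤ q) (a e : ℤ) :
    (fun z : ℤ × ℝ => invLength (κ * q) q (z.1 + a) (⌊z.2⌋ + e)) =Θ[⊤]
      fun z => scale (rowSize κ) z ^ q := by
  have hpos := fun z => (scale_pos (one_le_rowSize (zero_le_one.trans hκ)) z).le
  exact (isTheta_invLength hκ hq _ _).trans ((isTheta_scale_floor (zero_le_one.trans hκ) a e).rpow
    (.of_forall fun _ => hpos _) (.of_forall hpos))

theorem isBigO_invLength_sub_succ (hκ : 0 ≤ κ) (hq : 1 ≤ q) (p : ℝ) (a e : ℤ) :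
    (fun z : ℤ × ℝ => invLength p q (z.1 + a) (⌊z.2⌋ + e + 1) -
      invLength p q (z.1 + a) (⌊z.2⌋ + e)) =O[⊤] fun z => scale (rowSize κ) z ^ (q - 1) := by
  have hsucc : (fun z : ℤ × ℝ => |((⌊z.2⌋ + e + 1 : ℤ) : ℝ)| - |((⌊z.2⌋ + e : ℤ) : ℝ)|) =O[⊤]
      fun _ => (1 : ℝ) := .of_norm_le fun z => by
    refine (abs_abs_sub_abs_le_abs_sub _ _).trans ?_
    simp
  have hsize : (fun z : ℤ × ℝ => 1 + |((⌊z.2⌋ + e : ℤ) : ℝ)|) =O[⊤] scale (rowSize κ) := by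
    have hone := (isBigO_one_rowSize (l := ⊤) hκ Prod.fst).trans
      (isBigO_fst_scale (one_le_rowSize hκ) _ Prod.snd)
    have hfloor := ((isBigO_floor_add_sub_one Prod.snd e).trans hone).add
      (isBigO_snd_scale (one_le_rowSize hκ) Prod.fst _)
    simp only [sub_add_cancel] at hfloor
    exact hone.add hfloor.abs_left
  refine ((isBigO_rpow_sub_rpow hq (fun _ => abs_nonneg _) hsucc).trans
    (hsize.rpow (sub_nonneg.2 hq)
      (.of_forall fun z => (scale_pos (one_le_rowSize hκ) z).le))).congr_left fun z => ?_
  simp only [invLength]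
  ring

theorem isBigO_invLength_sub_row (hκ : 1 ≤ κ) (hq : 1 ≤ q) (a : ℤ) (j : ℤ × ℝ → ℤ) :
    (fun z : ℤ × ℝ => invLength (κ * q) q (z.1 + a) (j z) - invLength (κ * q) q z.1 (j z)) =O[⊤]
      fun z => scale (rowSize κ) z ^ (q - 1 / κ) := by
  have hκ₀ : 0 < κ := zero_lt_one.trans_le hκ
  have hshift : (fun z : ℤ × ℝ => |((z.1 + a : ℤ) : ℝ)| - |(z.1 : ℝ)|) =O[⊤]
      fun _ => (1 : ℝ) := .trans (.of_norm_le fun z => abs_abs_sub_abs_le_abs_sub _ _)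
    (isBigO_intCast_add_sub_one _ a).norm_left
  have hpow := isBigO_rpow_sub_rpow (one_le_mul_of_one_le_of_one_le hκ hq)
    (fun _ => abs_nonneg _) hshift
  have hexp : κ * q - 1 = κ * (q - 1 / κ) := by field_simp
  simp only [hexp, ← rowSize_rpow] at hpow
  have hκq : 0 ≤ q - 1 / κ := sub_nonneg.2 (((div_le_one hκ₀).2 hκ).trans hq)
  refine (hpow.trans ((isBigO_fst_scale (one_le_rowSize hκ₀.le) _ _).rpow hκq
    (.of_forall fun z => (scale_pos (one_le_rowSize hκ₀.le) z).le))).congr_left fun z => ?_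
  simp only [invLength]
  ring

end Lengths

section Subdivision

variable {p q : ℝ}

theorem summable_abs_rpow_add_one_rpow_neg {r η : ℝ} (hη : 0 ≤ η) (hrη : 1 < r * η) :
    Summable fun i : ℤ => (|(i : ℝ)| ^ r + 1) ^ (-η) := by
  refine .of_norm_bounded_eventually (Real.summable_abs_int_rpow hrη) ?_
  filter_upwards [(finite_singleton (0 : ℤ)).compl_mem_cofinite] with i hi
  have hi₀ : 0 < |(i : ℝ)| := by simpa using hi
  rw [Real.norm_of_nonneg (by positivity), ← mul_neg, Real.rpow_mul hi₀.le]
  exact Real.rpow_le_rpow_of_nonpos (Real.rpow_pos_of_pos hi₀ r) (by linarith)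
    (neg_nonpos.2 hη)

theorem inv_add_add_one_le_mul {x y θ : ℝ} (hx : 0 ≤ x) (hy : 0 ≤ y) (hθ₀ : 0 ≤ θ)
    (hθ₁ : θ ≤ 1) : (x + y + 1)⁻¹ ≤ (x + 1) ^ (-θ) * (y + 1) ^ (-(1 - θ)) := by
  have hamgm := Real.geom_mean_le_arith_mean2_weighted hθ₀ (sub_nonneg.2 hθ₁)
    (by positivity : 0 ≤ x + 1) (by positivity : 0 ≤ y + 1) (by ring)
  rw [Real.rpow_neg (by positivity), Real.rpow_neg (by positivity), ← mul_inv]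
  refine inv_anti₀ (by positivity) (hamgm.trans ?_)
  linarith [mul_nonneg (sub_nonneg.2 hθ₁) hx, mul_nonneg hθ₀ hy]

theorem summable_blockLength (hp : 0 < p) (hq : 0 < q) (hpq : 1 / p + 1 / q < 1) :
    Summable (blockLength p q) := by
  obtain ⟨θ, hpθ, hθq⟩ := exists_between (lt_sub_iff_add_lt.2 hpq)
  have hθ₀ : 0 ≤ θ := (one_div_pos.2 hp).le.trans hpθ.le
  have hθ₁ : θ ≤ 1 := hθq.le.trans (sub_le_self 1 (one_div_pos.2 hq).le)
  rw [div_lt_iff₀' hp] at hpθ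
  rw [lt_sub_comm, div_lt_iff₀' hq] at hθq
  rw [← (toLex (α := ℤ × ℤ)).summable_iff]
  refine .of_nonneg_of_le (fun n => (blockLength_pos p q _).le) (fun n => ?_)
    ((summable_abs_rpow_add_one_rpow_neg hθ₀ hpθ).mul_of_nonneg
      (summable_abs_rpow_add_one_rpow_neg (sub_nonneg.2 hθ₁) hθq)
      (fun i => by positivity) fun j => by positivity)
  exact (blockLength_toLex p q n.1 n.2).trans_le
    (inv_add_add_one_le_mul (by positivity) (by positivity) hθ₀ hθ₁)

theorem invLength_le_three_mul (hq₁ : 1 ≤ q) (hq₂ : q ≤ 2) (i : ℤ) {j k : ℤ}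
    (hjk : |k - j| ≤ 1) : invLength p q i j ≤ 3 * invLength p q i k := by
  have habs : |(j : ℝ)| ≤ |(k : ℝ)| + 1 := by
    have hjk' : |(k : ℝ) - j| ≤ 1 := by exact_mod_cast hjk
    linarith [abs_sub_abs_le_abs_sub (j : ℝ) k, abs_sub_comm (j : ℝ) k]
  have hconst : (2 : ℝ) ^ (q - 1) ≤ 2 :=
    (Real.rpow_le_rpow_of_exponent_le one_le_two (by linarith)).trans_eq (Real.rpow_one 2)
  have hpow : |(j : ℝ)| ^ q ≤ 2 * (|(k : ℝ)| ^ q + 1) := calc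
    |(j : ℝ)| ^ q ≤ (|(k : ℝ)| + 1) ^ q := by gcongr
    _ ≤ 2 ^ (q - 1) * (|(k : ℝ)| ^ q + 1 ^ q) :=
      add_rpow_le_mul_rpow_add_rpow hq₁ (abs_nonneg _) zero_le_one
    _ ≤ 2 * (|(k : ℝ)| ^ q + 1) := by rw [Real.one_rpow]; gcongr
  have hi : 0 ≤ |(i : ℝ)| ^ p := by positivity
  have hk : 0 ≤ |(k : ℝ)| ^ q := by positivity
  unfold invLength
  linarith

/-- The lengths of the intervals `I_{i,j}`, normalized to have total mass one. -/
def normLength (p q : ℝ) (n : ℤ ×ₗ ℤ) : ℝ := blockLength p q n / totalLength p q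

theorem normLength_toLex (p q : ℝ) (i j : ℤ) :
    normLength p q (toLex (i, j)) = (totalLength p q)⁻¹ * (invLength p q i j)⁻¹ :=
  (div_eq_inv_mul _ _).trans (congrArg _ (blockLength_toLex p q i j))

theorem totalLength_pos (hs : Summable (blockLength p q)) : 0 < totalLength p q :=
  hs.tsum_pos (fun n => (blockLength_pos p q n).le) (toLex (0, 0)) (blockLength_pos p q _)

theorem isSubdivision_normLength (hs : Summable (blockLength p q)) (hq₁ : 1 ≤ q) (hq₂ : q ≤ 2) :
    IsSubdivision (normLength p q) where
  pos n := div_pos (blockLength_pos p q n) (totalLength_pos hs)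
  hasSum := by
    have hsum := hs.hasSum.div_const (totalLength p q)
    rwa [← totalLength, div_self (totalLength_pos hs).ne'] at hsum
  le_three_mul i j k hjk := by
    have hinv := inv_anti₀ (invLength_pos p q i j) (invLength_le_three_mul hq₁ hq₂ i hjk)
    rw [mul_inv, inv_mul_le_iff₀ three_pos] at hinv
    rw [normLength_toLex, normLength_toLex, mul_left_comm]
    exact mul_le_mul_of_nonneg_left hinv (inv_nonneg.2 (totalLength_pos hs).le)

end Subdivision

section Decay

/-- Polynomial decay of the densities of a subdivision, of their derivatives, and of the
differences of both between two rows. -/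
structure HasDecay (v : ℤ ×ₗ ℤ → ℝ) (κ q : ℝ) : Prop where
  rho_isTheta : (fun z : ℤ × ℝ => rho v z.1 z.2) =Θ[⊤] fun z => scale (rowSize κ) z ^ (-q)
  rhoDeriv_isBigO : (fun z : ℤ × ℝ => rhoDeriv v z.1 z.2) =O[⊤]
    fun z => scale (rowSize κ) z ^ (-q - 1)
  rho_sub_isBigO (a : ℤ) : (fun z : ℤ × ℝ => rho v (z.1 + a) z.2 - rho v z.1 z.2) =O[⊤]
    fun z => scale (rowSize κ) z ^ (-q - 1 / κ)
  rhoDeriv_sub_isBigO (a : ℤ) :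
    (fun z : ℤ × ℝ => rhoDeriv v (z.1 + a) z.2 - rhoDeriv v z.1 z.2) =O[⊤]
      fun z => scale (rowSize κ) z ^ (-q - 1 / κ - 1)

variable {κ q : ℝ}

theorem isTheta_normLength_floor (hκ : 1 ≤ κ) (hq : 1 ≤ q)
    (hs : Summable (blockLength (κ * q) q)) (e : ℤ) :
    (fun z : ℤ × ℝ => normLength (κ * q) q (toLex (z.1, ⌊z.2⌋ + e))) =Θ[⊤]
      fun z => scale (rowSize κ) z ^ (-q) := by
  have hpos := scale_pos (one_le_rowSize (zero_le_one.trans hκ))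
  simp only [normLength_toLex]
  refine (isTheta_const_mul_left (inv_ne_zero (totalLength_pos hs).ne')).2 ?_
  simpa only [add_zero] using isTheta_inv_rpow hpos (isTheta_invLength_floor hκ hq 0 e)

theorem isBigO_normLength_sub_succ (hκ : 1 ≤ κ) (hq : 1 ≤ q) (e : ℤ) :
    (fun z : ℤ × ℝ => normLength (κ * q) q (toLex (z.1, ⌊z.2⌋ + e + 1)) -
      normLength (κ * q) q (toLex (z.1, ⌊z.2⌋ + e))) =O[⊤]
        fun z => scale (rowSize κ) z ^ (-q - 1) := by
  have hκ₀ := zero_le_one.trans hκ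
  have hw := isTheta_invLength_floor hκ hq 0
  have hinv := isBigO_inv_sub_inv (scale_pos (one_le_rowSize hκ₀)) (hw (e + 1)) (hw e)
    (fun _ => (invLength_pos _ _ _ _).ne') (fun _ => (invLength_pos _ _ _ _).ne')
    (by simpa only [add_assoc] using isBigO_invLength_sub_succ hκ₀ hq (κ * q) 0 e)
  simpa only [normLength_toLex, mul_sub, add_zero, add_assoc] using
    hinv.const_mul_left (totalLength (κ * q) q)⁻¹

theorem isBigO_normLength_sub_row (hκ : 1 ≤ κ) (hq : 1 ≤ q) (a e : ℤ) :
    (fun z : ℤ × ℝ => normLength (κ * q) q (toLex (z.1 + a, ⌊z.2⌋ + e)) -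
      normLength (κ * q) q (toLex (z.1, ⌊z.2⌋ + e))) =O[⊤]
        fun z => scale (rowSize κ) z ^ (-q - 1 / κ) := by
  have hw := fun a => isTheta_invLength_floor hκ hq a e
  have hinv := isBigO_inv_sub_inv (scale_pos (one_le_rowSize (zero_le_one.trans hκ)))
    (hw a) (hw 0)
    (fun _ => (invLength_pos _ _ _ _).ne') (fun _ => (invLength_pos _ _ _ _).ne')
    (by simpa only [add_zero] using isBigO_invLength_sub_row hκ hq a fun z => ⌊z.2⌋ + e)
  simpa only [normLength_toLex, mul_sub, add_zero] using
    hinv.const_mul_left (totalLength (κ * q) q)⁻¹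

theorem isBigO_normLength_mixed_sub (hκ : 1 ≤ κ) (hq : 1 ≤ q) (a e : ℤ) :
    (fun z : ℤ × ℝ =>
      (normLength (κ * q) q (toLex (z.1 + a, ⌊z.2⌋ + e + 1)) -
        normLength (κ * q) q (toLex (z.1, ⌊z.2⌋ + e + 1))) -
      (normLength (κ * q) q (toLex (z.1 + a, ⌊z.2⌋ + e)) -
        normLength (κ * q) q (toLex (z.1, ⌊z.2⌋ + e)))) =O[⊤]
      fun z => scale (rowSize κ) z ^ (-q - 1 / κ - 1) := by
  have hκ₀ := zero_le_one.trans hκ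
  have hw := isTheta_invLength_floor hκ hq
  have hne := fun i j => (invLength_pos (κ * q) q i j).ne'
  have hinv := isBigO_mixed_inv_sub_inv (scale_pos (one_le_rowSize hκ₀))
    (hw 0 e) (hw 0 (e + 1)) (hw a e) (hw a (e + 1))
    (fun _ => hne _ _) (fun _ => hne _ _) (fun _ => hne _ _) (fun _ => hne _ _)
    (fun z => by simp only [invLength, add_zero]; ring)
    (by simpa only [add_assoc] using isBigO_invLength_sub_succ hκ₀ hq (κ * q) 0 e)
    (by simpa only [add_zero] using isBigO_invLength_sub_row hκ hq a fun z => ⌊z.2⌋ + e)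
  simpa only [normLength_toLex, mul_sub, add_zero, add_assoc] using
    hinv.const_mul_left (totalLength (κ * q) q)⁻¹

theorem isTheta_rho_normLength (hκ : 1 ≤ κ) (hq₁ : 1 ≤ q) (hq₂ : q ≤ 2)
    (hs : Summable (blockLength (κ * q) q)) :
    (fun z : ℤ × ℝ => rho (normLength (κ * q) q) z.1 z.2) =Θ[⊤]
      fun z => scale (rowSize κ) z ^ (-q) := by
  have hv := isSubdivision_normLength hs hq₁ hq₂
  have hlength := isTheta_normLength_floor hκ hq₁ hs
  refine ⟨isBigO_density fun e _ => (hlength e).1, (hlength 0).2.trans (.of_bound 2 ?_)⟩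
  refine .of_forall fun z => ?_
  rw [add_zero, Real.norm_of_nonneg (hv.pos _).le, Real.norm_of_nonneg (hv.rho_pos _ _).le]
  linarith [hv.half_le_rho z.1 z.2]

theorem hasDecay_normLength (hκ : 1 ≤ κ) (hq₁ : 1 ≤ q) (hq₂ : q ≤ 2)
    (hs : Summable (blockLength (κ * q) q)) : HasDecay (normLength (κ * q) q) κ q where
  rho_isTheta := isTheta_rho_normLength hκ hq₁ hq₂ hs
  rhoDeriv_isBigO := isBigO_densityDeriv fun e _ => isBigO_normLength_sub_succ hκ hq₁ e
  rho_sub_isBigO a := by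
    simp only [rho, ← density_sub]
    exact isBigO_density fun e _ => isBigO_normLength_sub_row hκ hq₁ a e
  rhoDeriv_sub_isBigO a := by
    simp only [rhoDeriv, ← densityDeriv_sub]
    exact isBigO_densityDeriv fun e _ => isBigO_normLength_mixed_sub hκ hq₁ a e

end Decay

section Regularity

variable {v : ℤ ×ₗ ℤ → ℝ} {κ q α x y : ℝ} {a : ℤ} {P : ℤ → ℤ}

theorem IsSubdivision.hasDerivAt_rhoRatio_sub_one (hv : IsSubdivision v) (a : ℤ) (P : ℤ → ℤ)
    (i : ℤ) (t : ℝ) : HasDerivAt (fun t => rhoRatio v a P i t - 1)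
      (((rhoDeriv v (i + a) (t + P i) - rhoDeriv v i t) * rho v i t -
        (rho v (i + a) (t + P i) - rho v i t) * rhoDeriv v i t) / rho v i t ^ 2) t := by
  have hnum : HasDerivAt (fun s => rho v (i + a) (s + P i)) (rhoDeriv v (i + a) (t + P i)) t :=
    (hasDerivAt_rho v (i + a) (t + P i)).comp_add_const t _
  refine ((hnum.div (hasDerivAt_rho v i t) (hv.rho_pos i t).ne').sub_const 1).congr_deriv ?_
  ring

theorem tendsto_scale_rpow_neg {ι : Type*} (T : ι → ℝ) (hx : 0 < x) (i : ι) :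
    Tendsto (fun t => scale T (i, t) ^ (-x)) (cocompact ℝ) (𝓝 0) :=
  (tendsto_rpow_neg_atTop hx).comp
    (tendsto_atTop_add_const_left _ (T i) (tendsto_norm_cocompact_atTop (E := ℝ)))

theorem isBigO_fst_rowSize (hκ : 0 ≤ κ) (hy : 0 ≤ y)
    (hP : (fun i => (P i : ℝ)) =O[⊤] fun i => rowSize κ i ^ (1 - y)) :
    (fun z : ℤ × ℝ => (P z.1 : ℝ)) =O[⊤] fun z => rowSize κ z.1 := by
  have hrow : (fun i => (P i : ℝ)) =O[⊤] rowSize κ := hP.trans <| by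
    simpa only [Real.rpow_one] using isBigO_rpow_of_le (one_le_rowSize hκ) (sub_le_self 1 hy)
  exact hrow.comp_tendsto tendsto_top

namespace HasDecay

variable (hdecay : HasDecay v κ q) (hκ : 0 ≤ κ)
include hdecay hκ

theorem isBigO_rhoRatio_sub_one (hv : IsSubdivision v)
    (hsub : (fun z : ℤ × ℝ => rho v (z.1 + a) (z.2 + P z.1) - rho v z.1 z.2) =O[⊤]
      fun z => scale (rowSize κ) z ^ (-q - x)) :
    (fun z : ℤ × ℝ => rhoRatio v a P z.1 z.2 - 1) =O[⊤]
      fun z => scale (rowSize κ) z ^ (-x) := by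
  have hpos := scale_pos (one_le_rowSize hκ)
  refine (isBigO_mul_rpow hpos hsub (isTheta_inv_rpow hpos hdecay.rho_isTheta).1).congr
    (fun z => ?_) fun z => by ring_nf
  rw [← div_eq_mul_inv, sub_div, div_self (hv.rho_pos _ _).ne', rhoRatio]

theorem isBigO_deriv_rhoRatio
    (hsub : (fun z : ℤ × ℝ => rho v (z.1 + a) (z.2 + P z.1) - rho v z.1 z.2) =O[⊤]
      fun z => scale (rowSize κ) z ^ (-q - x))
    (hsub' : (fun z : ℤ × ℝ => rhoDeriv v (z.1 + a) (z.2 + P z.1) - rhoDeriv v z.1 z.2) =O[⊤]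
      fun z => scale (rowSize κ) z ^ (-q - y)) (hyx : y ≤ x + 1) :
    (fun z : ℤ × ℝ => ((rhoDeriv v (z.1 + a) (z.2 + P z.1) - rhoDeriv v z.1 z.2) * rho v z.1 z.2 -
      (rho v (z.1 + a) (z.2 + P z.1) - rho v z.1 z.2) * rhoDeriv v z.1 z.2) /
        rho v z.1 z.2 ^ 2) =O[⊤] fun z => scale (rowSize κ) z ^ (-y) := by
  have hpos := scale_pos (one_le_rowSize hκ)
  have hinv := (isTheta_inv_rpow hpos hdecay.rho_isTheta).1
  have hleft := isBigO_mul_rpow hpos hsub' hdecay.rho_isTheta.1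
  have hright := (isBigO_mul_rpow hpos hsub hdecay.rhoDeriv_isBigO).trans
    (isBigO_rpow_of_le (one_le_scale (one_le_rowSize hκ))
      (by linarith : -q - x + (-q - 1) ≤ -q - y + -q))
  refine (isBigO_mul_rpow hpos (hleft.sub hright) (isBigO_mul_rpow hpos hinv hinv)).congr
    (fun z => ?_) fun z => by ring_nf
  rw [div_eq_mul_inv, sq, mul_inv]

theorem isC1Holder_action (hv : IsSubdivision v) (hα₀ : 0 < α) (hα₁ : α ≤ 1) (hx : 0 < x)
    (hqx : α * (q - 1) ≤ x) (hqxy : q * α ≤ x * (1 - α) + y * α) (hyx : y ≤ x + 1)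
    (hsub : (fun z : ℤ × ℝ => rho v (z.1 + a) (z.2 + P z.1) - rho v z.1 z.2) =O[⊤]
      fun z => scale (rowSize κ) z ^ (-q - x))
    (hsub' : (fun z : ℤ × ℝ => rhoDeriv v (z.1 + a) (z.2 + P z.1) - rhoDeriv v z.1 z.2) =O[⊤]
      fun z => scale (rowSize κ) z ^ (-q - y)) :
    IsC1Holder α (hv.action (skew a P)) := by
  have hratio := hdecay.isBigO_rhoRatio_sub_one hκ hv hsub
  obtain ⟨M, hM, hrow⟩ := exists_abs_sub_le_mul_rpow (one_le_rowSize hκ) hα₀.le hα₁ hqx hqxy hratio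
    (hv.hasDerivAt_rhoRatio_sub_one a P) (hdecay.isBigO_deriv_rhoRatio hκ hsub hsub' hyx)
    hv.hasDerivAt_chart (fun i => (hv.chart_strictMono i).monotone) hdecay.rho_isTheta.2
  refine hv.isC1Holder_action hα₀ hM (fun i s t => ?_) fun i => ?_
  · simpa only [sub_sub_sub_cancel_right] using hrow i s t
  · have hzero : Tendsto (fun t => rhoRatio v a P i t - 1) (cocompact ℝ) (𝓝 0) :=
      ((hratio.comp_tendsto (tendsto_top (f := fun t : ℝ => (i, t)))).trans_tendsto
        (tendsto_scale_rpow_neg (rowSize κ) hx i))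
    simpa only [sub_add_cancel, zero_add] using hzero.add_const 1

theorem isC1Holder_action_shift (hv : IsSubdivision v) (hα₀ : 0 < α) (hα₁ : α ≤ 1) (hq : 1 < q)
    (hqκ : α * (q - 1) = 1 / κ) (a : ℤ) : IsC1Holder α (hv.action (skew a 0)) := by
  refine hdecay.isC1Holder_action hκ hv hα₀ hα₁ (x := 1 / κ) (y := 1 / κ + 1)
    (hqκ ▸ mul_pos hα₀ (sub_pos.2 hq)) hqκ.le (by linear_combination hqκ) le_rfl ?_ ?_
  · simpa only [Pi.zero_apply, Int.cast_zero, add_zero] using hdecay.rho_sub_isBigO a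
  · simpa only [Pi.zero_apply, Int.cast_zero, add_zero, sub_sub] using
      hdecay.rhoDeriv_sub_isBigO a

theorem isBigO_rhoDeriv_of_sub {r : ℤ × ℝ → ℝ}
    (hr : (fun z => r z - z.2) =O[⊤] fun z => rowSize κ z.1) :
    (fun z : ℤ × ℝ => rhoDeriv v z.1 (r z)) =O[⊤] fun z => scale (rowSize κ) z ^ (-q - 1) := by
  have hpos := fun z => (scale_pos (one_le_rowSize hκ) z).le
  have hscale : (fun z : ℤ × ℝ => scale (rowSize κ) (z.1, r z)) =Θ[⊤] scale (rowSize κ) :=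
    isTheta_scale_rowSize hκ (by simpa only [sub_self] using isBigO_zero _ _) hr
  exact (hdecay.rhoDeriv_isBigO.comp_tendsto
    (tendsto_top (f := fun z : ℤ × ℝ => (z.1, r z)))).trans
      (hscale.rpow (.of_forall fun _ => hpos _) (.of_forall hpos)).1

theorem isBigO_rho_shear_sub (hy₀ : 0 ≤ y) (hy₁ : y ≤ 1)
    (hP : (fun i => (P i : ℝ)) =O[⊤] fun i => rowSize κ i ^ (1 - y)) :
    (fun z : ℤ × ℝ => rho v z.1 (z.2 + P z.1) - rho v z.1 z.2) =O[⊤]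
      fun z => scale (rowSize κ) z ^ (-q - y) := by
  have hP' : (fun z : ℤ × ℝ => (P z.1 : ℝ)) =O[⊤] fun z => rowSize κ z.1 ^ (1 - y) :=
    hP.comp_tendsto tendsto_top
  obtain ⟨r, hr, heq⟩ := exists_sub_eq_and_abs_sub_le (hasDerivAt_rho v) (Prod.fst : ℤ × ℝ → ℤ)
    (fun z => z.2 + P z.1) Prod.snd
  simp only [add_sub_cancel_left] at hr heq
  have hderiv := hdecay.isBigO_rhoDeriv_of_sub hκ ((IsBigO.of_norm_le hr).trans
    (isBigO_fst_rowSize hκ hy₀ hP).norm_left)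
  have hPscale := hP'.trans ((isBigO_fst_scale (one_le_rowSize hκ) _ Prod.snd).rpow
    (sub_nonneg.2 hy₁) (.of_forall fun z => (scale_pos (one_le_rowSize hκ) _).le))
  exact (isBigO_mul_rpow (scale_pos (one_le_rowSize hκ)) hderiv hPscale).congr
    (fun z => (heq z).symm) fun z => by ring_nf

theorem isC1Holder_action_shear (hv : IsSubdivision v) (hα₀ : 0 < α) (hα₁ : α ≤ 1) (hy₀ : 0 < y)
    (hy₁ : y ≤ 1) (hqy : α * (q - 1) ≤ y * (1 - α))
    (hP : (fun i => (P i : ℝ)) =O[⊤] fun i => rowSize κ i ^ (1 - y)) :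
    IsC1Holder α (hv.action (skew 0 P)) := by
  have hrow := isBigO_fst_rowSize hκ hy₀.le hP
  refine hdecay.isC1Holder_action hκ hv hα₀ hα₁ (x := y) (y := 1) hy₀
    (hqy.trans (mul_le_of_le_one_right hy₀.le (sub_le_self 1 hα₀.le))) (by linarith)
    (le_add_of_nonneg_left hy₀.le) ?_ ?_
  · simpa only [add_zero] using hdecay.isBigO_rho_shear_sub hκ hy₀.le hy₁ hP
  · simp only [add_zero]
    exact (hdecay.isBigO_rhoDeriv_of_sub hκ
      (by simpa only [add_sub_cancel_left] using hrow)).sub hdecay.rhoDeriv_isBigO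

end HasDecay

end Regularity

section Generators

variable {α κ p q : ℝ}

theorem isBigO_risingBinom {l : Filter ℤ} (k : ℕ) :
    (fun i : ℤ => (risingBinom k i : ℝ)) =O[l] fun i => (1 + |(i : ℝ)|) ^ k := by
  have hfactor : ∀ m ∈ Finset.range k, (fun i : ℤ => ((i + m : ℤ) : ℝ)) =O[l]
      fun i => 1 + |(i : ℝ)| := fun m _ => by
    refine .of_bound (m + 1) (.of_forall fun i => ?_)
    rw [Real.norm_of_nonneg (by positivity : 0 ≤ 1 + |(i : ℝ)|), Real.norm_eq_abs]
    push_cast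
    refine (abs_add_le _ _).trans ?_
    rw [Nat.abs_cast]
    linarith [mul_nonneg m.cast_nonneg (abs_nonneg (i : ℝ))]
  have hprod := (IsBigO.finsetProd hfactor).const_mul_left ((k ! : ℝ)⁻¹)
  simp only [Finset.prod_const, Finset.card_range] at hprod
  refine hprod.congr_left fun i => ?_
  rw [inv_mul_eq_iff_eq_mul₀ (by positivity), ← Int.cast_prod, ← factorial_mul_risingBinom]
  push_cast
  rfl

theorem isBigO_risingBinom_rowSize (hκ : 0 < κ) {k n : ℕ} (hkn : k ≤ n) :
    (fun i => (risingBinom k i : ℝ)) =O[⊤] fun i => rowSize κ i ^ (1 - (1 - n / κ)) := by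
  refine (isBigO_risingBinom k).trans (.of_norm_le fun i => ?_)
  rw [Real.norm_of_nonneg (by positivity), rowSize_rpow, sub_sub_cancel, mul_div_cancel₀ _ hκ.ne',
    Real.rpow_natCast]
  exact pow_le_pow_right₀ (le_add_of_nonneg_right (abs_nonneg _)) hkn

theorem exists_exponents (hα₀ : 0 < α) (hα₁ : α < 1) (n : ℕ) :
    ∃ κ q : ℝ, 1 ≤ κ ∧ 1 < q ∧ q ≤ 2 ∧ α * (q - 1) = 1 / κ ∧ 1 / (κ * q) + 1 / q < 1 ∧
      1 / κ ≤ (1 - n / κ) * (1 - α) := by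
  obtain ⟨κ, hκ⟩ : ∃ κ, κ = n + 1 / (1 - α) + 1 / α := ⟨_, rfl⟩
  have hα' : 0 < 1 - α := sub_pos.2 hα₁
  have hone : 1 ≤ 1 / (1 - α) := (one_le_div hα').2 (sub_le_self 1 hα₀.le)
  have hinv : 0 < 1 / α := one_div_pos.2 hα₀
  have hκ₀ : 0 < κ := by linarith
  have hακ : 1 ≤ α * κ := (div_le_iff₀' hα₀).1 (by linarith)
  have hnκ : 1 ≤ (κ - n) * (1 - α) := (div_le_iff₀ hα').1 (by linarith)
  have hlt : 1 / κ < 1 / (α * κ) :=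
    one_div_lt_one_div_of_lt (by positivity) (mul_lt_of_lt_one_left hκ₀ hα₁)
  have hle : 1 / (α * κ) ≤ 1 := (div_le_one (by positivity)).2 hακ
  have hpos : 0 < 1 / κ := one_div_pos.2 hκ₀
  refine ⟨κ, 1 + 1 / (α * κ), by linarith, by linarith, by linarith, ?_, ?_, ?_⟩
  · field_simp
    ring
  · rw [← div_div, ← add_div, div_lt_one (by linarith)]
    linarith
  · rw [one_sub_div hκ₀.ne', div_mul_eq_mul_div]
    gcongr

theorem HasDecay.action_shift_mem_diffPlus {v : ℤ ×ₗ ℤ → ℝ} (hdecay : HasDecay v κ q)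
    (hv : IsSubdivision v) (hκ : 0 ≤ κ) (hα₀ : 0 < α) (hα₁ : α ≤ 1) (hq : 1 < q)
    (hqκ : α * (q - 1) = 1 / κ) (a : ℤ) : hv.action (skew a 0) ∈ DiffPlus α := by
  have hC1 := hdecay.isC1Holder_action_shift hκ hv hα₀ hα₁ hq hqκ
  have hinv := hC1 (-a)
  rw [← skew_zero_right_inv, map_inv] at hinv
  exact ⟨hC1 a, hinv⟩

theorem HasDecay.action_shear_mem_diffPlus {v : ℤ ×ₗ ℤ → ℝ} (hdecay : HasDecay v κ q)
    (hv : IsSubdivision v) (hκ : 0 ≤ κ) (hα₀ : 0 < α) (hα₁ : α ≤ 1) {y : ℝ} (hy₀ : 0 < y)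
    (hy₁ : y ≤ 1) (hqy : α * (q - 1) ≤ y * (1 - α)) {P : ℤ → ℤ}
    (hP : (fun i => (P i : ℝ)) =O[⊤] fun i => rowSize κ i ^ (1 - y)) :
    hv.action (skew 0 P) ∈ DiffPlus α := by
  have hinv := hdecay.isC1Holder_action_shear hκ hv hα₀ hα₁ hy₀ hy₁ hqy
    (by simpa only [Pi.neg_apply, Int.cast_neg] using hP.neg_left : (fun i => ((-P) i : ℝ)) =O[⊤] _)
  rw [← skew_zero_left_inv, map_inv] at hinv
  exact ⟨hdecay.isC1Holder_action_shear hκ hv hα₀ hα₁ hy₀ hy₁ hqy hP, hinv⟩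

theorem block_eq_Icc (hv : IsSubdivision (normLength p q)) (i j : ℤ) :
    block p q i j = Icc (embed (normLength p q) (toLex (i, (j : ℝ))))
      (embed (normLength p q) (toLex (i, (j : ℝ) + 1))) := by
  have hleft : blockLeft p q (toLex (i, j)) = leftEnd (normLength p q) (toLex (i, j)) :=
    tsum_div_const.symm
  ext x
  rw [block, mem_ofPred_eq, mem_Icc, mem_Icc, ← Subtype.coe_le_coe, ← Subtype.coe_le_coe,
    hv.coe_embed, hv.coe_embed, ← Int.cast_one, ← Int.cast_add, chart_intCast, chart_intCast,
    hv.leftEnd_succ, hleft, normLength]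

theorem action_image_block (hv : IsSubdivision (normLength p q)) (a : ℤ) (P : ℤ → ℤ) (i j : ℤ) :
    hv.action (skew a P) '' block p q i j = block p q (i + a) (j + P i) := by
  rw [block_eq_Icc hv, block_eq_Icc hv, hv.action_image_Icc]

theorem isMetabelian_and_isNilpotent_of_map_eq {G G' : Type*} [Group G] [Group G'] {n : ℕ}
    {S : Subgroup G} {ψ : G →* G'} {θ : ((ℤ ×ₗ ℝ) ≃o (ℤ ×ₗ ℝ)) →* G'}
    (hψ : Function.Injective ψ) (hθ : Function.Injective θ)
    (hmap : S.map ψ = (modelGroup (n + 1)).map θ) :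
    IsMetabelian S ∧ Group.IsNilpotent S ∧ Group.nilpotencyClass S = n + 1 := by
  have hseries : ∀ k, S.lowerCentralSeries k = ⊥ ↔ (modelGroup (n + 1)).lowerCentralSeries k = ⊥ :=
    fun k => by
      rw [← lowerCentralSeries_map_eq_bot_iff hψ, hmap, lowerCentralSeries_map_eq_bot_iff hθ]
  refine ⟨?_, isNilpotent_and_nilpotencyClass_eq_succ
    ((hseries _).2 (lowerCentralSeries_modelGroup_eq_bot n))
    ((hseries _).not.2 (lowerCentralSeries_modelGroup_ne_bot n))⟩
  rw [← isMetabelian_map_iff hψ, hmap, isMetabelian_map_iff hθ]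
  exact isMetabelian_modelGroup n

theorem map_closure_eq_map_modelGroup {G G' : Type*} [Group G] [Group G'] {d : ℕ} {f : G}
    {g : Fin d → G} {ψ : G →* G'} {θ : ((ℤ ×ₗ ℝ) ≃o (ℤ ×ₗ ℝ)) →* G'} (hf : ψ f = θ (skew 1 0))
    (hg : ∀ k, ψ (g k) = θ (skew 0 (risingBinom k))) :
    (Subgroup.closure (insert f (range g))).map ψ = (modelGroup d).map θ := by
  rw [modelGroup, MonoidHom.map_closure, MonoidHom.map_closure, image_insert_eq, image_insert_eq,
    ← range_comp, ← range_comp, hf]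
  exact congrArg (fun h => Subgroup.closure (insert (θ (skew 1 0)) (range h))) (funext hg)

end Generators

end HolderDiff

end

open HolderDiff in
theorem theoremC (α : ℝ) (hα₀ : 0 < α) (hα₁ : α < 1) (d : ℕ) (hd : 1 ≤ d) :
    ∃ (p q : ℝ) (f : DiffPlus α) (g : Fin d → DiffPlus α) (Γ : Subgroup (DiffPlus α)),
      1 < p ∧ 1 < q ∧ Summable (blockLength p q) ∧
      (∀ i j : ℤ, (f : I ≃o I) '' block p q i j = block p q (i + 1) j) ∧
      (∀ (k : Fin d) (i j : ℤ),
        (g k : I ≃o I) '' block p q i j = block p q i (j + risingBinom k i)) ∧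
      Γ = Subgroup.closure (insert f (Set.range g)) ∧
      IsMetabelian Γ ∧ Group.IsNilpotent Γ ∧ Group.nilpotencyClass Γ = d := by
  obtain ⟨n, rfl⟩ := Nat.exists_eq_add_of_le' hd
  obtain ⟨κ, q, hκ, hq₁, hq₂, hqκ, hpq, hy⟩ := exists_exponents hα₀ hα₁ n
  have hκ₀ : 0 < κ := one_pos.trans_le hκ
  have hp : 1 < κ * q := one_lt_mul_of_le_of_lt hκ hq₁
  have hs : Summable (blockLength (κ * q) q) :=
    summable_blockLength (one_pos.trans hp) (one_pos.trans hq₁) hpq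
  have hv := isSubdivision_normLength hs hq₁.le hq₂
  have hdecay := hasDecay_normLength hκ hq₁.le hq₂ hs
  have hy₀ : 0 < 1 - n / κ :=
    pos_of_mul_pos_left ((one_div_pos.2 hκ₀).trans_le hy) (sub_pos.2 hα₁).le
  have hy₁ : 1 - n / κ ≤ 1 := sub_le_self 1 (by positivity)
  have hf : hv.action (skew 1 0) ∈ DiffPlus α :=
    hdecay.action_shift_mem_diffPlus hv hκ₀.le hα₀ hα₁.le hq₁ hqκ 1
  have hg (k : Fin (n + 1)) : hv.action (skew 0 (risingBinom k)) ∈ DiffPlus α :=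
    hdecay.action_shear_mem_diffPlus hv hκ₀.le hα₀ hα₁.le hy₀ hy₁ (hqκ.trans_le hy)
      (isBigO_risingBinom_rowSize hκ₀ (Nat.lt_succ_iff.1 k.2))
  refine ⟨κ * q, q, ⟨_, hf⟩, fun k => ⟨_, hg k⟩, _, hp, hq₁, hs, fun i j => ?_, fun k i j => ?_,
    rfl, isMetabelian_and_isNilpotent_of_map_eq (DiffPlus α).subtype_injective hv.action_injective
      (map_closure_eq_map_modelGroup rfl fun _ => rfl)⟩
  · simpa only [Pi.zero_apply, add_zero] using action_image_block hv 1 0 i j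
  · simpa only [add_zero] using action_image_block hv 0 (risingBinom k) i j
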